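/- Theorem. Every polynomial permutation class has a \textsf{Struct} cover, and the rules of the cover can be taken to be the empty rule and matrices of peg permutations. Definitions. A permutation of length $n\ge 0$ is a bijection of $[n]=\{1,\dots,n\}$, written as a word; $\pi$ contains $p$ if some subword of $\pi$ is order isomorphic to $p$. For a set $P$ of permutations, let $\mathrm{Sub}(P)$ be the set of all permutations contained in some member of $P$, and $\mathrm{Av}(P)$ the set of all permutations that contain no member of $P$. A permutation class is a set $\mathcal C$ of permutations with $\mathrm{Sub}(\mathcal C)=\mathcal C$. It is polynomial if there is a polynomial $q$ such that the number of members of $\mathcal C$ of length $n$ is $q(n)$ for all sufficiently large $n$. A basis of $\mathcal C$ is a set $B$ with $\mathcal C=\mathrm{Av}(B)$ and $\mathrm{Sub}(\{p\})\cap B=\{p\}$ for all $p\in B$. The block set of $\mathcal C$ consists of: the infinite classes $\mathrm{Av}(B')$ with $B'\subseteq \mathrm{Sub}(B)$ and $B'\cap\mathrm{Sub}(\{p\})\ne\emptyset$ for all $p\in B$, where $B$ is the basis of $\mathcal C$; the class $\mathrm{Av}(1)=\{\epsilon\}$; and the point $\{1\}$, if $1\in\mathcal C$. For $X,Y\subseteq[n]$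 and $\pi$ of length $n$, $\pi(X\times Y)$ is the permutation order isomorphic to the subword of $\pi$ with indices in $X$ and values in $Y$. Let $M$ be a $t\times u$ matrix (columns indexed from left to right, rows from bottom to top) of sets of permutations. An $M$-gridding of $\pi$ is a pair of sequences $1=c_1\le\dots\le c_{t+1}=n+1$, $1=r_1\le\dots\le r_{u+1}=n+1$ such that $\pi([c_k,c_{k+1})\times[r_l,r_{l+1}))\in M_{k,l}$ for all $k\in[t]$, $l\in[u]$. The generalized grid class $\mathrm{Grid}(M)$ is the set of permutations that have an $M$-gridding. $M$ is a \textsf{Struct} rule if each entry is a permutation class or the point $\{1\}$, and every $\pi\in\mathrm{Grid}(M)$ has exactly one $M$-gridding. The empty rule is the $1\times1$ matrix with entry $\{\epsilon\}$, and the trivial rule for $\mathcal C$ is the $1\times 1$ matrix with entry $\mathcal C$. A peg permutation is a permutation $\rho$ each of whose letters is decorated with $+$, $-$ or $\circ$; its matrix $M_\rho$ has, in column $i$ and row $\rho(i)$, the entry $\mathrm{Av}(21)$, $\mathrm{Av}(12)$ or $\{1\}$ according as the decoration of $\rho(i)$ is $+$, $-$ or $\circ$, and all its other entries are $\{\epsilon\}$.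 Statement. For every polynomial permutation class $\mathcal C$ there are finitely many \textsf{Struct} rules $\mathcal R_1,\dots,\mathcal R_K$ such that \[ \mathcal C=\mathrm{Grid}(\mathcal R_1)\sqcup\dots\sqcup\mathrm{Grid}(\mathcal R_K) \] is a disjoint union, all entries of all $\mathcal R_i$ belong to the block set of $\mathcal C$, no $\mathcal R_i$ is the trivial rule for $\mathcal C$ (except that the empty rule is allowed also when $\mathcal C=\{\epsilon\}$), and each $\mathcal R_i$ is either the empty rule or the matrix $M_\rho$ of a non-empty peg permutation $\rho$. -/

import Mathlib

/-- Permutations of all finite lengths `n ≥ 0`; positions and values are `0, …, n - 1`. -/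
abbrev Permutation : Type := Σ n : ℕ, Equiv.Perm (Fin n)

namespace Permutation

/-- The length of a permutation. -/
abbrev length (π : Permutation) : ℕ := π.1

/-- The value of `π` at position `i`. -/
abbrev val (π : Permutation) (i : Fin π.length) : Fin π.length := π.2 i

/-- The permutation `1` of length one (the point). -/
def one : Permutation := ⟨1, Equiv.refl _⟩

/-- The increasing permutation `12`. -/
def p12 : Permutation := ⟨2, Equiv.refl _⟩

/-- The decreasing permutation `21`. -/
def p21 : Permutation := ⟨2, Fin.revPerm⟩

/-- `Contains π p`: some subword of `π` is order isomorphic to `p`. -/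
def Contains (π p : Permutation) : Prop :=
  ∃ f : Fin p.length → Fin π.length, StrictMono f ∧
    ∀ i j, p.val i < p.val j ↔ π.val (f i) < π.val (f j)

/-- The standardization of the subword of `π` with positions in `S`: the `a`-th position in `S` is
sent to the rank of its value among the values of `π` on `S`. -/
def restrict (π : Permutation) (S : Finset (Fin π.length)) : Permutation :=
  ⟨S.card,
    (S.orderIsoOfFin rfl).toEquiv.trans
      ((π.2.subtypeEquiv (p := fun i => i ∈ S) (q := fun v => v ∈ S.map π.2.toEmbedding)
          (fun i => by simp)).trans
        ((S.map π.2.toEmbedding).orderIsoOfFin (by simp)).toEquiv.symm)⟩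

/-- The restriction is order isomorphic to the subword it comes from. -/
theorem restrict_val_lt_iff (π : Permutation) (S : Finset (Fin π.length)) (i j : Fin S.card) :
    (π.restrict S).val i < (π.restrict S).val j ↔
      π.val (S.orderIsoOfFin rfl i) < π.val (S.orderIsoOfFin rfl j) := by
  exact ((S.map π.2.toEmbedding).orderIsoOfFin (by simp)).symm.lt_iff_lt

/-- `π(X × Y)` for the half-open intervals `X = [a, b)` and `Y = [a', b')`. -/
def box (π : Permutation) (a b a' b' : ℕ) : Permutation :=
  π.restrict (Finset.univ.filter fun i =>
    (a ≤ (i : ℕ) ∧ (i : ℕ) < b) ∧ (a' ≤ (π.val i : ℕ) ∧ (π.val i : ℕ) < b'))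

end Permutation

/-- The set of all patterns contained in some member of `P`. -/
def subpatterns (P : Set Permutation) : Set Permutation :=
  {p | ∃ π ∈ P, π.Contains p}

/-- A permutation class: a set of permutations equal to its set of subpatterns. -/
def IsPermClass (C : Set Permutation) : Prop :=
  subpatterns C = C

/-- The permutations avoiding every pattern in `P`. -/
def Av (P : Set Permutation) : Set Permutation :=
  {π | ∀ p ∈ P, ¬ π.Contains p}

/-- `B` is the basis of the class `C`. -/
def IsBasis (B C : Set Permutation) : Prop :=
  C = Av B ∧ ∀ p ∈ B, subpatterns {p} ∩ B = {p}

/-- The number of members of `C` of length `n`. -/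
noncomputable def countOfLength (C : Set Permutation) (n : ℕ) : ℕ :=
  {σ : Equiv.Perm (Fin n) | (⟨n, σ⟩ : Permutation) ∈ C}.ncard

/-- The number of members of length `n` agrees with a polynomial for all sufficiently large `n`. -/
def IsPolynomialClass (C : Set Permutation) : Prop :=
  IsPermClass C ∧
    ∃ q : Polynomial ℚ, ∃ N : ℕ, ∀ n ≥ N, (countOfLength C n : ℚ) = q.eval (n : ℚ)

/-- The block set of `C`: the infinite classes `Av(B')` with `B'` a set of subpatterns of the basis
`B` of `C` that meets the subpatterns of every member of `B`; the class consisting of the empty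
permutation only; and the point, if it lies in `C`. -/
def blockSet (C : Set Permutation) : Set (Set Permutation) :=
  {D | ∃ B B' : Set Permutation, IsBasis B C ∧ B' ⊆ subpatterns B ∧
      (∀ p ∈ B, (B' ∩ subpatterns {p}).Nonempty) ∧ D = Av B' ∧ D.Infinite} ∪
    {Av {Permutation.one}} ∪
    {D | D = {Permutation.one} ∧ Permutation.one ∈ C}

/-- A matrix of sets of permutations, indexed by column (left to right) and row (bottom to top). -/
structure GridMatrix where
  cols : ℕ
  rows : ℕ
  entry : Fin cols → Fin rows → Set Permutation

namespace GridMatrix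

/-- The pairs of sequences `(c, r)` of cuts that form an `M`-gridding of `π`. As positions and values
start at `0`, the cuts run from `0` to the length of `π`. -/
def IsGridding (M : GridMatrix) (π : Permutation)
    (g : (Fin (M.cols + 1) → ℕ) × (Fin (M.rows + 1) → ℕ)) : Prop :=
  (Monotone g.1 ∧ g.1 0 = 0 ∧ g.1 (Fin.last M.cols) = π.length) ∧
  (Monotone g.2 ∧ g.2 0 = 0 ∧ g.2 (Fin.last M.rows) = π.length) ∧
  ∀ (k : Fin M.cols) (l : Fin M.rows),
    π.box (g.1 k.castSucc) (g.1 k.succ) (g.2 l.castSucc) (g.2 l.succ) ∈ M.entry k l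

/-- The generalized grid class of `M`. -/
def Grid (M : GridMatrix) : Set Permutation :=
  {π | ∃ g, M.IsGridding π g}

/-- A Struct rule: every entry is a permutation class or the point, and every permutation in the
grid class has a unique gridding. -/
def IsStructRule (M : GridMatrix) : Prop :=
  (∀ k l, IsPermClass (M.entry k l) ∨ M.entry k l = {Permutation.one}) ∧
    ∀ π ∈ M.Grid, ∃! g, M.IsGridding π g

/-- The `1 × 1` matrix with entry `D`. -/
def single (D : Set Permutation) : GridMatrix :=
  ⟨1, 1, fun _ _ => D⟩

/-- The empty rule, whose grid class consists of the empty permutation only. -/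
def emptyRule : GridMatrix :=
  single (Av {Permutation.one})

end GridMatrix

/-- `R 0, …, R (K - 1)` is a Struct cover of `C`: every `R i` is a Struct rule with entries in the
block set of `C`; the trivial rule, with the single entry `C`, does not occur (except that the empty
rule may always occur); the grid classes are pairwise disjoint, and their union is `C`. -/
def IsStructCover (C : Set Permutation) {K : ℕ} (R : Fin K → GridMatrix) : Prop :=
  (∀ i, (R i).IsStructRule) ∧
  (∀ i k l, (R i).entry k l ∈ blockSet C) ∧
  (∀ i, R i = GridMatrix.single C → R i = GridMatrix.emptyRule) ∧
  (∀ i j, i ≠ j → Disjoint (R i).Grid (R j).Grid) ∧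
  (⋃ i, (R i).Grid) = C

/-- The decorations `+`, `-` and `∘` of the letters of a peg permutation. -/
inductive Peg where
  | plus
  | minus
  | dot

/-- The increasing permutations for `+`, the decreasing ones for `-`, the point for `∘`. -/
def Peg.cell : Peg → Set Permutation
  | .plus => Av {Permutation.p21}
  | .minus => Av {Permutation.p12}
  | .dot => {Permutation.one}

/-- A permutation each of whose letters is decorated by `+`, `-` or `∘`. -/
structure PegPermutation where
  perm : Permutation
  peg : Fin perm.length → Peg

/-- The matrix of `ρ`: the entry in column `i` and row `ρ(i)` is given by the decoration of the
`i`-th letter, and all other entries contain the empty permutation only. -/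
def PegPermutation.matrix (ρ : PegPermutation) : GridMatrix where
  cols := ρ.perm.length
  rows := ρ.perm.length
  entry i j := if ρ.perm.val i = j then (ρ.peg i).cell else Av {Permutation.one}

/-!
A *run* of a permutation is a maximal set of consecutive positions whose values are consecutive
and monotone. Collapsing every run to a point gives the run shape of the permutation
(`exists_isRunShape`): a peg permutation that records the relative order and the directions of the
runs. It is unique (`IsRunShape.shape_eq`, `IsRunShape.map_eq`), and together with the lengths of the
runs it determines the permutation (`IsPegMap.eq_of_blockSize_eq`).

A polynomial class `C` has fewer than `2 ^ m` members of length at most `3 * m + 1` for some `m`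
(`exists_ncard_lt_two_pow`), and this bounds the number of runs of its members
(`card_runStarts_le`). Indeed, at every start of a run but the first, some point separates the values
at two consecutive positions. If one point separates `m` disjoint pairs of this kind, it gives `2 ^ m`
patterns together with one freely chosen point of each pair (`two_pow_le_of_common_separator`).
Otherwise the relation "a point that belongs to one pair separates another pair" has bounded
out-degree, so if there are many pairs, `m` of them can be chosen whose separators separate no other
chosen pair, and keeping or dropping each separator again gives `2 ^ m` patterns
(`two_pow_le_of_private_separators`).

So there are finitely many run shapes, and for each of them the possible vectors of run lengths form a
downward closed set. By Dickson's lemma there is a threshold `N` such that membership in `C` depends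
only on the run shape and on the run lengths truncated at `N` (`exists_isThreshold`,
`IsThreshold.mem_of_truncate_eq`). A truncation class is the grid class of one peg permutation: a run
of length `l < N` becomes `l` dots, and a run of length at least `N` becomes `N` dots followed by a
letter decorated with the direction of the run (`rulePeg`). As `N ≥ 2`, the directions can be read off
the permutation, so griddings are unique and different truncation classes are disjoint
(`IsRunShape.comp`, `pegMap_rulePeg_unique`, `eq_of_pegMap_rulePeg`). A decoration `+` occurs only if `C`
contains all increasing permutations. Then every basis element of `C` contains `21`, and hence `Av 21`
belongs to the block set; similarly for `-` (`IsThreshold.cell_mem_blockSet`).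
-/

/-! ### Containment and restriction -/

namespace Permutation

theorem Contains.refl (π : Permutation) : π.Contains π :=
  ⟨id, strictMono_id, fun _ _ => Iff.rfl⟩

theorem Contains.trans {π p q : Permutation} (h : π.Contains p) (h' : p.Contains q) :
    π.Contains q := by
  obtain ⟨f, hf, hf'⟩ := h
  obtain ⟨g, hg, hg'⟩ := h'
  exact ⟨f ∘ g, hf.comp hg, fun i j => (hg' i j).trans (hf' _ _)⟩

/-- A permutation is determined by the relative order of its values. -/
theorem eq_of_lt_iff {n : ℕ} {σ τ : Equiv.Perm (Fin n)}
    (h : ∀ i j, σ i < σ j ↔ τ i < τ j) : σ = τ := by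
  have hm : StrictMono (τ ∘ σ.symm) := fun a b hab => by
    have := (h (σ.symm a) (σ.symm b)).1 (by simpa using hab)
    simpa using this
  let e : Fin n ≃o Fin n := hm.orderIsoOfSurjective _ (σ.symm.trans τ).surjective
  have he : e = OrderIso.refl _ := Subsingleton.elim _ _
  ext i
  have h1 : e (σ i) = σ i := by rw [he]; rfl
  have h2 : e (σ i) = τ i := by
    change τ (σ.symm (σ i)) = τ i
    simp
  rw [← h1, h2]

theorem contains_length_le {π p : Permutation} (h : π.Contains p) : p.length ≤ π.length := by
  obtain ⟨f, hf, -⟩ := h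
  simpa using Fintype.card_le_of_injective f hf.injective

theorem Contains.eq_of_length_eq {π p : Permutation} (h : π.Contains p)
    (hl : p.length = π.length) : p = π := by
  obtain ⟨n, σ⟩ := π
  obtain ⟨m, τ⟩ := p
  obtain rfl : m = n := hl
  obtain ⟨f, hf, hf'⟩ := h
  have hid : ∀ i, f i = i := by
    let e : Fin m ≃o Fin m := hf.orderIsoOfSurjective _
      (Finite.surjective_of_injective hf.injective)
    have he : e = OrderIso.refl _ := Subsingleton.elim _ _
    intro i
    change e i = i
    rw [he]; rfl
  congr 1
  refine eq_of_lt_iff fun i j => ?_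
  have := hf' i j
  rw [hid, hid] at this
  exact this

theorem contains_restrict (π : Permutation) (S : Finset (Fin π.length)) :
    π.Contains (π.restrict S) :=
  ⟨fun i => S.orderIsoOfFin rfl i, fun _ _ h => (S.orderIsoOfFin rfl).strictMono h,
    fun i j => π.restrict_val_lt_iff S i j⟩

theorem restrict_contains_iff (π p : Permutation) (S : Finset (Fin π.length)) :
    (π.restrict S).Contains p ↔ ∃ f : Fin p.length → Fin π.length, StrictMono f ∧
      (∀ i, f i ∈ S) ∧ ∀ i j, p.val i < p.val j ↔ π.val (f i) < π.val (f j) := by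
  constructor
  · rintro ⟨f, hf, hf'⟩
    refine ⟨fun i => S.orderIsoOfFin rfl (f i), fun a b h => ?_, fun i => ?_, fun i j => ?_⟩
    · exact (S.orderIsoOfFin rfl).strictMono (hf h)
    · exact (S.orderIsoOfFin rfl (f i)).2
    · rw [hf']; exact π.restrict_val_lt_iff S _ _
  · rintro ⟨f, hf, hS, hf'⟩
    refine ⟨fun i => (S.orderIsoOfFin rfl).symm ⟨f i, hS i⟩, fun a b h => ?_, fun i j => ?_⟩
    · exact (S.orderIsoOfFin rfl).symm.strictMono (hf h)
    · rw [hf']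
      refine Iff.trans ?_ (π.restrict_val_lt_iff S _ _).symm
      simp

/-- Two subwords that are order isomorphic to the same permutation are matched by an isomorphism
of positions and values. -/
theorem exists_orderIso_of_restrict_eq {π : Permutation} {S T : Finset (Fin π.length)}
    (h : π.restrict S = π.restrict T) :
    ∃ φ : S ≃o T, ∀ x y : S, π.val x < π.val y ↔ π.val (φ x) < π.val (φ y) := by
  have key : ∀ (τ : Permutation) (U : Finset (Fin π.length)), τ = π.restrict U →
      ∃ e : Fin τ.length ≃o U, ∀ i j, τ.val i < τ.val j ↔ π.val (e i) < π.val (e j) := by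
    rintro τ U rfl
    exact ⟨U.orderIsoOfFin rfl, fun i j => π.restrict_val_lt_iff U i j⟩
  obtain ⟨e, he⟩ := key _ S rfl
  obtain ⟨e', he'⟩ := key _ T h
  refine ⟨e.symm.trans e', fun x y => ?_⟩
  have h1 := he (e.symm x) (e.symm y)
  have h2 := he' (e.symm x) (e.symm y)
  simp only [OrderIso.apply_symm_apply] at h1
  exact h1.symm.trans h2

theorem contains_one_iff (π : Permutation) : π.Contains one ↔ 0 < π.length := by
  constructor
  · intro h
    exact contains_length_le h
  · intro h
    refine ⟨fun _ => ⟨0, h⟩, fun a b hab => ?_, fun i j => ?_⟩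
    · exact absurd hab (by have := Subsingleton.elim (α := Fin 1) a b; rw [this]; exact lt_irrefl _)
    · have := Subsingleton.elim (α := Fin 1) i j
      subst this
      simp

theorem eq_one_iff (π : Permutation) : π = one ↔ π.length = 1 := by
  constructor
  · rintro rfl; rfl
  · obtain ⟨n, σ⟩ := π
    intro h
    obtain rfl : n = 1 := h
    exact congrArg (Sigma.mk 1) (Subsingleton.elim (α := Equiv.Perm (Fin 1)) _ _)

theorem restrict_eq_one_iff (π : Permutation) (S : Finset (Fin π.length)) :
    π.restrict S = one ↔ ∃ p, S = {p} :=
  (eq_one_iff _).trans Finset.card_eq_one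

theorem restrict_mem_Av_one_iff (π : Permutation) (S : Finset (Fin π.length)) :
    π.restrict S ∈ Av {one} ↔ S = ∅ := by
  simp only [Av, Set.mem_ofPred_eq, Set.mem_singleton_iff, forall_eq, contains_one_iff]
  change ¬ 0 < S.card ↔ _
  simp

theorem restrict_mem_Av_p21_iff (π : Permutation) (S : Finset (Fin π.length)) :
    π.restrict S ∈ Av {p21} ↔ ∀ p ∈ S, ∀ q ∈ S, p < q → π.val p < π.val q := by
  simp only [Av, Set.mem_ofPred_eq, Set.mem_singleton_iff, forall_eq, restrict_contains_iff]
  constructor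
  · intro h p hp q hq hpq
    by_contra hn
    have hlt : π.val q < π.val p :=
      lt_of_le_of_ne (not_lt.1 hn) fun e => hpq.ne' (π.2.injective e)
    refine h ⟨![p, q], ?_, ?_, ?_⟩
    · intro a b hab
      change Fin 2 at a b
      fin_cases a <;> fin_cases b <;> simp_all
    · intro i
      change Fin 2 at i
      fin_cases i <;> simp_all
    · intro i j
      change Fin 2 at i j
      fin_cases i <;> fin_cases j
      · exact iff_of_false (lt_irrefl _) (lt_irrefl _)
      · exact iff_of_false (by decide) (lt_asymm hlt)
      · exact iff_of_true (by decide) hlt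
      · exact iff_of_false (lt_irrefl _) (lt_irrefl _)
  · rintro h ⟨f, hf, hS, hf'⟩
    have h1 := h _ (hS (0 : Fin 2)) _ (hS (1 : Fin 2)) (hf (by decide))
    have h2 := (hf' (1 : Fin 2) (0 : Fin 2)).1 (by decide)
    exact lt_asymm h1 h2

theorem restrict_mem_Av_p12_iff (π : Permutation) (S : Finset (Fin π.length)) :
    π.restrict S ∈ Av {p12} ↔ ∀ p ∈ S, ∀ q ∈ S, p < q → π.val q < π.val p := by
  simp only [Av, Set.mem_ofPred_eq, Set.mem_singleton_iff, forall_eq, restrict_contains_iff]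
  constructor
  · intro h p hp q hq hpq
    by_contra hn
    have hlt : π.val p < π.val q :=
      lt_of_le_of_ne (not_lt.1 hn) fun e => hpq.ne (π.2.injective e)
    refine h ⟨![p, q], ?_, ?_, ?_⟩
    · intro a b hab
      change Fin 2 at a b
      fin_cases a <;> fin_cases b <;> simp_all
    · intro i
      change Fin 2 at i
      fin_cases i <;> simp_all
    · intro i j
      change Fin 2 at i j
      fin_cases i <;> fin_cases j
      · exact iff_of_false (lt_irrefl _) (lt_irrefl _)
      · exact iff_of_true (by decide) hlt
      · exact iff_of_false (by decide) (lt_asymm hlt)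
      · exact iff_of_false (lt_irrefl _) (lt_irrefl _)
  · rintro h ⟨f, hf, hS, hf'⟩
    have h1 := h _ (hS (0 : Fin 2)) _ (hS (1 : Fin 2)) (hf (by decide))
    have h2 := (hf' (0 : Fin 2) (1 : Fin 2)).1 (by decide)
    exact lt_asymm h1 h2

end Permutation

open Permutation

/-! ### Griddings of a peg permutation as maps between positions -/

/-- A peg map from `π` to the peg permutation `ρ`: it sends a position of `π` to the letter of `ρ`
whose cell contains the corresponding point. -/
structure IsPegMap (ρ : PegPermutation) (π : Permutation)
    (f : Fin π.length → Fin ρ.perm.length) : Prop where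
  mono : Monotone f
  lt_iff : ∀ p q, f p ≠ f q →
    (π.val p < π.val q ↔ ρ.perm.val (f p) < ρ.perm.val (f q))
  plus : ∀ p q, p < q → f p = f q → ρ.peg (f p) = .plus → π.val p < π.val q
  minus : ∀ p q, p < q → f p = f q → ρ.peg (f p) = .minus → π.val q < π.val p
  dot : ∀ i, ρ.peg i = .dot → ∃! p, f p = i

/-- The cuts of the gridding that corresponds to a peg map. -/
def pegCuts (ρ : PegPermutation) {n : ℕ} (f : Fin n → Fin ρ.perm.length) :
    (Fin (ρ.perm.length + 1) → ℕ) × (Fin (ρ.perm.length + 1) → ℕ) :=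
  (fun j => (Finset.univ.filter fun p => (f p).castSucc < j).card,
    fun j => (Finset.univ.filter fun p => (ρ.perm.val (f p)).castSucc < j).card)

theorem lt_card_filter_iff {n : ℕ} (P : Fin n → Prop) [DecidablePred P]
    (h : ∀ x y, x ≤ y → P y → P x) (x : Fin n) :
    (x : ℕ) < (Finset.univ.filter P).card ↔ P x := by
  constructor
  · intro hx
    by_contra hP
    have : Finset.univ.filter P ⊆ Finset.Iio x := fun y hy => by
      simp only [Finset.mem_filter, Finset.mem_univ, true_and] at hy
      rw [Finset.mem_Iio]
      by_contra hn
      exact hP (h _ _ (not_lt.1 hn) hy)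
    have := Finset.card_le_card this
    rw [Fin.card_Iio] at this
    omega
  · intro hP
    have : Finset.Iic x ⊆ Finset.univ.filter P := fun y hy => by
      simp only [Finset.mem_filter, Finset.mem_univ, true_and]
      exact h _ _ (Finset.mem_Iic.1 hy) hP
    have := Finset.card_le_card this
    rw [Fin.card_Iic] at this
    omega

theorem exists_cut_index {k n : ℕ} (c : Fin (k + 1) → ℕ) (h0 : c 0 = 0)
    (hl : c (Fin.last k) = n) {x : ℕ} (hx : x < n) :
    ∃ i : Fin k, c i.castSucc ≤ x ∧ x < c i.succ := by
  by_contra hn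
  push Not at hn
  have : ∀ j : Fin (k + 1), c j ≤ x := fun j => by
    induction j using Fin.induction with
    | zero => omega
    | succ i ih => exact hn i ih
  have := this (Fin.last k)
  omega

theorem lt_cut_iff {k : ℕ} {c : Fin (k + 1) → ℕ} (hc : Monotone c) {x : ℕ} {i : Fin k}
    (h1 : c i.castSucc ≤ x) (h2 : x < c i.succ) (j : Fin (k + 1)) :
    x < c j ↔ i.castSucc < j := by
  constructor
  · intro h
    by_contra hn
    have := hc (not_lt.1 hn)
    omega
  · intro h
    exact lt_of_lt_of_le h2 (hc (Fin.castSucc_lt_iff_succ_le.1 h))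

theorem card_filter_perm_eq {n : ℕ} (σ : Equiv.Perm (Fin n)) (P : Fin n → Prop)
    [DecidablePred P] :
    (Finset.univ.filter fun p => P (σ p)).card = (Finset.univ.filter P).card :=
  Finset.card_bij (fun p _ => σ p) (by simp) (by simp) fun b hb =>
    ⟨σ.symm b, by simpa using hb, by simp⟩

theorem card_filter_lt_nat {n c : ℕ} (hc : c ≤ n) :
    (Finset.univ.filter fun p : Fin n => (p : ℕ) < c).card = c := by
  rw [Fin.card_filter_val_lt]; omega

/-- Every gridding by the matrix of a peg permutation comes from a peg map. -/
theorem exists_pegMap_of_isGridding {ρ : PegPermutation} {π : Permutation} {g}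
    (h : ρ.matrix.IsGridding π g) : ∃ f, IsPegMap ρ π f ∧ g = pegCuts ρ f := by
  obtain ⟨⟨hc, hc0, hcl⟩, ⟨hr, hr0, hrl⟩, hb⟩ := h
  obtain ⟨c, r⟩ := g
  change Fin (ρ.perm.length + 1) → ℕ at c r
  change Monotone c at hc
  change Monotone r at hr
  change c 0 = 0 at hc0
  change r 0 = 0 at hr0
  change c (Fin.last ρ.perm.length) = _ at hcl
  change r (Fin.last ρ.perm.length) = _ at hrl
  have hcn : ∀ j, c j ≤ π.length := fun j => hcl ▸ hc (Fin.le_last j)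
  have hrn : ∀ j, r j ≤ π.length := fun j => hrl ▸ hr (Fin.le_last j)
  change ∀ k l : Fin ρ.perm.length, π.box (c k.castSucc) (c k.succ) (r l.castSucc) (r l.succ) ∈
    (if ρ.perm.val k = l then (ρ.peg k).cell else Av {one}) at hb
  choose f hf using fun p : Fin π.length => exists_cut_index c hc0 hcl p.2
  choose l hl using fun p : Fin π.length => exists_cut_index r hr0 hrl (π.val p).2
  have hfl : ∀ p, ρ.perm.val (f p) = l p := fun p => by
    by_contra hn
    have := hb (f p) (l p)
    rw [if_neg hn, box, restrict_mem_Av_one_iff] at this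
    exact Finset.notMem_empty p (this ▸ by simp only [Finset.mem_filter, Finset.mem_univ, true_and]; exact ⟨hf p, hl p⟩)
  have hclt : ∀ (p : Fin π.length) j, (p : ℕ) < c j ↔ (f p).castSucc < j := fun p j =>
    lt_cut_iff hc (hf p).1 (hf p).2 j
  have hrlt : ∀ p j, (π.val p : ℕ) < r j ↔ (ρ.perm.val (f p)).castSucc < j := fun p j => by
    rw [hfl]; exact lt_cut_iff hr (hl p).1 (hl p).2 j
  have hmem : ∀ p i, p ∈ (Finset.univ.filter fun p : Fin π.length =>
      (c i.castSucc ≤ (p : ℕ) ∧ (p : ℕ) < c i.succ) ∧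
      (r (ρ.perm.val i).castSucc ≤ (π.val p : ℕ) ∧ (π.val p : ℕ) < r (ρ.perm.val i).succ)) ↔
      f p = i := fun p i => by
    simp only [Finset.mem_filter, Finset.mem_univ, true_and]
    constructor
    · rintro ⟨⟨h1, h2⟩, -⟩
      rw [hclt, Fin.castSucc_lt_succ_iff] at h2
      rw [← not_lt, hclt, not_lt, Fin.castSucc_le_castSucc_iff] at h1
      exact le_antisymm h2 h1
    · rintro rfl
      exact ⟨hf p, hfl p ▸ hl p⟩
  have hcell : ∀ i, π.restrict (Finset.univ.filter fun p : Fin π.length =>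
      (c i.castSucc ≤ (p : ℕ) ∧ (p : ℕ) < c i.succ) ∧
      (r (ρ.perm.val i).castSucc ≤ (π.val p : ℕ) ∧ (π.val p : ℕ) < r (ρ.perm.val i).succ)) ∈
      (ρ.peg i).cell := fun i => by
    have := hb i (ρ.perm.val i)
    rwa [if_pos rfl] at this
  refine ⟨f, ⟨fun p q hpq => ?_, fun p q hne => ?_, fun p q hpq he hp => ?_,
    fun p q hpq he hp => ?_, fun i hi => ?_⟩, ?_⟩
  · have h1 := (hf p).1
    have h2 := (hclt q (f q).succ).2 Fin.castSucc_lt_succ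
    have h3 : (p : ℕ) < c (f q).succ := lt_of_le_of_lt hpq h2
    rwa [hclt, Fin.castSucc_lt_succ_iff] at h3
  · have key : ∀ p q, ρ.perm.val (f p) < ρ.perm.val (f q) → π.val p < π.val q := fun p q h => by
      have h1 := (hrlt p (ρ.perm.val (f q)).castSucc).2 (by simpa using h)
      have h2 : ¬ (π.val q : ℕ) < r (ρ.perm.val (f q)).castSucc := by
        rw [hrlt]; exact lt_irrefl _
      rw [Fin.lt_def]; omega
    refine ⟨fun h => ?_, key p q⟩
    by_contra hn
    exact lt_asymm h (key q p (lt_of_le_of_ne (not_lt.1 hn)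
      fun e => hne (ρ.perm.2.injective e).symm))
  · have := hcell (f p)
    rw [hp] at this
    exact (restrict_mem_Av_p21_iff _ _).1 this p ((hmem _ _).2 rfl) q ((hmem _ _).2 he.symm) hpq
  · have := hcell (f p)
    rw [hp] at this
    exact (restrict_mem_Av_p12_iff _ _).1 this p ((hmem _ _).2 rfl) q ((hmem _ _).2 he.symm) hpq
  · have := hcell i
    rw [hi] at this
    obtain ⟨p, hp⟩ := (restrict_eq_one_iff _ _).1 this
    refine ⟨p, (hmem p i).1 (hp ▸ Finset.mem_singleton_self p), fun q hq => ?_⟩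
    have := (hmem q i).2 hq
    rw [hp] at this
    exact Finset.mem_singleton.1 this
  · have h1 : c = fun j => (Finset.univ.filter fun p => (f p).castSucc < j).card := by
      funext j
      rw [← card_filter_lt_nat (hcn j)]
      simp only [hclt]
    have h2 : r = fun j => (Finset.univ.filter fun p => (ρ.perm.val (f p)).castSucc < j).card := by
      funext j
      rw [← card_filter_lt_nat (hrn j), ← card_filter_perm_eq π.2]
      simp only [← hrlt]
    exact Prod.ext h1 h2

theorem IsPegMap.isGridding {ρ : PegPermutation} {π : Permutation} {f}
    (h : IsPegMap ρ π f) : ρ.matrix.IsGridding π (pegCuts ρ f) := by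
  have hclt : ∀ (p : Fin π.length) j, (p : ℕ) < (pegCuts ρ f).1 j ↔ (f p).castSucc < j := fun p j =>
    lt_card_filter_iff _ (fun x y hxy hy => lt_of_le_of_lt (by simpa using h.mono hxy) hy) p
  have hrlt : ∀ p j, (π.val p : ℕ) < (pegCuts ρ f).2 j ↔
      (ρ.perm.val (f p)).castSucc < j := fun p j => by
    have := lt_card_filter_iff (fun v => (ρ.perm.val (f (π.2.symm v))).castSucc < j)
      (fun x y hxy hy => by
        by_contra hn
        have hlt := lt_of_lt_of_le hy (not_lt.1 hn)
        rw [Fin.castSucc_lt_castSucc_iff] at hlt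
        have hne : f (π.2.symm y) ≠ f (π.2.symm x) := fun e => by rw [e] at hlt; exact lt_irrefl _ hlt
        have := (h.lt_iff _ _ hne).2 hlt
        simp only [val, Equiv.apply_symm_apply] at this
        exact absurd hxy (not_le.2 this)) (π.val p)
    rw [← card_filter_perm_eq π.2] at this
    simpa [pegCuts] using this
  refine ⟨⟨?_, ?_, ?_⟩, ⟨?_, ?_, ?_⟩, ?_⟩
  · intro a b hab
    change (Finset.univ.filter fun p => (f p).castSucc < a).card ≤
      (Finset.univ.filter fun p => (f p).castSucc < b).card
    exact Finset.card_le_card (Finset.monotone_filter_right _ fun p _ hp => lt_of_lt_of_le hp hab)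
  · change (Finset.univ.filter fun p => (f p).castSucc < 0).card = 0
    simp
  · change (Finset.univ.filter fun p => (f p).castSucc < Fin.last _).card = π.length
    simp [Fin.castSucc_lt_last]
  · intro a b hab
    change (Finset.univ.filter fun p => (ρ.perm.val (f p)).castSucc < a).card ≤
      (Finset.univ.filter fun p => (ρ.perm.val (f p)).castSucc < b).card
    exact Finset.card_le_card (Finset.monotone_filter_right _ fun p _ hp => lt_of_lt_of_le hp hab)
  · change (Finset.univ.filter fun p => (ρ.perm.val (f p)).castSucc < 0).card = 0
    simp
  · change (Finset.univ.filter fun p => (ρ.perm.val (f p)).castSucc < Fin.last _).card = π.length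
    simp [Fin.castSucc_lt_last]
  · change ∀ k l : Fin ρ.perm.length, π.restrict (Finset.univ.filter fun p : Fin π.length =>
      ((pegCuts ρ f).1 k.castSucc ≤ (p : ℕ) ∧ (p : ℕ) < (pegCuts ρ f).1 k.succ) ∧
      ((pegCuts ρ f).2 l.castSucc ≤ (π.val p : ℕ) ∧ (π.val p : ℕ) < (pegCuts ρ f).2 l.succ)) ∈
      (if ρ.perm.val k = l then (ρ.peg k).cell else Av {one})
    intro k l
    have hS : (Finset.univ.filter fun p : Fin π.length =>
      ((pegCuts ρ f).1 k.castSucc ≤ (p : ℕ) ∧ (p : ℕ) < (pegCuts ρ f).1 k.succ) ∧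
      ((pegCuts ρ f).2 l.castSucc ≤ (π.val p : ℕ) ∧ (π.val p : ℕ) < (pegCuts ρ f).2 l.succ)) =
      Finset.univ.filter fun p => f p = k ∧ ρ.perm.val k = l := by
      refine Finset.filter_congr fun p _ => ?_
      rw [← not_lt, ← not_lt (b := (pegCuts ρ f).2 l.castSucc), hclt, hclt, hrlt, hrlt,
        Fin.castSucc_lt_succ_iff, Fin.castSucc_lt_succ_iff, not_lt, not_lt,
        Fin.castSucc_le_castSucc_iff, Fin.castSucc_le_castSucc_iff]
      constructor
      · rintro ⟨⟨h1, h2⟩, h3, h4⟩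
        have e := le_antisymm h2 h1
        exact ⟨e, e ▸ le_antisymm h4 h3⟩
      · rintro ⟨rfl, rfl⟩
        exact ⟨⟨le_rfl, le_rfl⟩, le_rfl, le_rfl⟩
    rw [hS]
    by_cases hkl : ρ.perm.val k = l
    · rw [if_pos hkl]
      simp only [hkl, and_true]
      cases hk : ρ.peg k with
      | plus =>
        refine (restrict_mem_Av_p21_iff _ _).2 fun p hp q hq hpq => ?_
        simp only [Finset.mem_filter, Finset.mem_univ, true_and] at hp hq
        exact h.plus p q hpq (hp.trans hq.symm) (hp ▸ hk)
      | minus =>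
        refine (restrict_mem_Av_p12_iff _ _).2 fun p hp q hq hpq => ?_
        simp only [Finset.mem_filter, Finset.mem_univ, true_and] at hp hq
        exact h.minus p q hpq (hp.trans hq.symm) (hp ▸ hk)
      | dot =>
        obtain ⟨p, hp, hu⟩ := h.dot k hk
        refine (restrict_eq_one_iff _ _).2 ⟨p, ?_⟩
        ext q
        simp only [Finset.mem_filter, Finset.mem_univ, true_and, Finset.mem_singleton]
        exact ⟨hu q, fun e => e ▸ hp⟩
    · rw [if_neg hkl, restrict_mem_Av_one_iff]
      simp [hkl]

theorem mem_grid_matrix_iff {ρ : PegPermutation} {π : Permutation} :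
    π ∈ ρ.matrix.Grid ↔ ∃ f, IsPegMap ρ π f :=
  ⟨fun ⟨_, hg⟩ => let ⟨f, hf, _⟩ := exists_pegMap_of_isGridding hg; ⟨f, hf⟩,
    fun ⟨_, hf⟩ => ⟨_, hf.isGridding⟩⟩

/-! ### Block sizes -/

/-- The number of positions in block `i` of the block map `f`. -/
def blockSize {n k : ℕ} (f : Fin n → Fin k) (i : Fin k) : ℕ :=
  (Finset.univ.filter fun p => f p = i).card

theorem sum_blockSize {n k : ℕ} (f : Fin n → Fin k) : ∑ i, blockSize f i = n := by
  have := Finset.card_eq_sum_card_fiberwise (f := f) (s := Finset.univ) (t := Finset.univ)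
    (fun _ _ => Finset.mem_coe.2 (Finset.mem_univ _))
  simp only [Finset.card_univ, Fintype.card_fin] at this
  exact this.symm

/-- The points in the blocks before `j`, counted by blocks. For a monotone map this is the first position
of block `j`. -/
theorem sum_blockSize_lt {n k : ℕ} (f : Fin n → Fin k) (j : Fin k) :
    ∑ i ∈ Finset.univ.filter (· < j), blockSize f i =
      (Finset.univ.filter fun p => f p < j).card := by
  have := Finset.card_eq_sum_card_fiberwise (f := f)
    (s := Finset.univ.filter fun p => f p < j) (t := Finset.univ.filter (· < j))
    (fun p hp => by simpa using hp)
  rw [this]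
  refine Finset.sum_congr rfl fun i hi => ?_
  simp only [Finset.mem_filter, Finset.mem_univ, true_and] at hi
  rw [blockSize, Finset.filter_filter]
  congr 1
  refine Finset.filter_congr fun p _ => ?_
  exact ⟨fun e => ⟨e ▸ hi, e⟩, fun e => e.2⟩

theorem eq_of_blockSize_eq {n k : ℕ} {f f' : Fin n → Fin k} (hf : Monotone f)
    (hf' : Monotone f') (h : ∀ i, blockSize f i = blockSize f' i) : f = f' := by
  funext p
  refine eq_of_forall_gt_iff fun j => ?_
  rw [← lt_card_filter_iff (fun p => f p < j) (fun x y hxy hy => lt_of_le_of_lt (hf hxy) hy),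
    ← lt_card_filter_iff (fun p => f' p < j) (fun x y hxy hy => lt_of_le_of_lt (hf' hxy) hy),
    ← sum_blockSize_lt, ← sum_blockSize_lt]
  simp only [h]

/-- A permutation is determined by a peg permutation and the sizes of the blocks. -/
theorem IsPegMap.eq_of_blockSize_eq {σ : PegPermutation} {π π' : Permutation} {f f'}
    (h : IsPegMap σ π f) (h' : IsPegMap σ π' f') (hs : ∀ i, blockSize f i = blockSize f' i) :
    π = π' := by
  obtain ⟨n, s⟩ := π
  obtain ⟨n', s'⟩ := π'
  obtain rfl : n = n' := by
    have h1 := sum_blockSize f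
    have h2 := sum_blockSize f'
    simp only [hs] at h1
    exact h1.symm.trans h2
  obtain rfl : f = f' := _root_.eq_of_blockSize_eq h.mono h'.mono hs
  congr 1
  refine eq_of_lt_iff fun p q => ?_
  by_cases hne : f p = f q
  · have key : ∀ p q, p < q → f p = f q → (s p < s q ↔ s' p < s' q) := fun p q hpq hne => by
      cases hp : σ.peg (f p) with
      | plus => exact iff_of_true (h.plus p q hpq hne hp) (h'.plus p q hpq hne hp)
      | minus =>
        exact iff_of_false (lt_asymm (h.minus p q hpq hne hp))
          (lt_asymm (h'.minus p q hpq hne hp))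
      | dot => exact absurd ((h.dot _ hp).unique rfl hne.symm) hpq.ne
    rcases lt_trichotomy p q with hpq | rfl | hpq
    · exact key p q hpq hne
    · exact iff_of_false (lt_irrefl _) (lt_irrefl _)
    · have := key q p hpq hne.symm
      rw [← not_iff_not, not_lt, not_lt, (s.injective.ne hpq.ne).le_iff_lt,
        (s'.injective.ne hpq.ne).le_iff_lt]
      exact this
  · exact (h.lt_iff p q hne).trans (h'.lt_iff p q hne).symm

/-! ### Runs -/

/-- The value of `π` at `r` lies strictly between those at `p` and `q`. -/
def Separates (π : Permutation) (r p q : Fin π.length) : Prop :=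
  (π.val p < π.val r ∧ π.val r < π.val q) ∨ (π.val q < π.val r ∧ π.val r < π.val p)

/-- A new run starts at the position `q`: either `q` is the first position, or some value lies
strictly between those at `q` and at the position before it. -/
def IsRunStart (π : Permutation) (q : Fin π.length) : Prop :=
  ∀ p : Fin π.length, (p : ℕ) + 1 = q → ∃ r, Separates π r p q

open Classical in
/-- The first positions of the runs of `π`. -/
noncomputable def runStarts (π : Permutation) : Finset (Fin π.length) :=
  Finset.univ.filter (IsRunStart π)

theorem mem_runStarts {π : Permutation} {q : Fin π.length} :
    q ∈ runStarts π ↔ IsRunStart π q := by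
  simp [runStarts]

/-- A peg permutation in which no two consecutive letters can be merged to a single monotone
run, provided that the cells decorated with a sign have at least two points. -/
def PegPermutation.Compact (σ : PegPermutation) : Prop :=
  ∀ i j : Fin σ.perm.length, (i : ℕ) + 1 = j →
    (∃ l, Separates σ.perm l i j) ∨
    (σ.perm.val i < σ.perm.val j ∧ (σ.peg i = .minus ∨ σ.peg j = .minus)) ∨
    (σ.perm.val j < σ.perm.val i ∧ (σ.peg i = .plus ∨ σ.peg j = .plus))

/-- The peg map that sends every position of `π` to its run; `σ` records the relative order of the
runs and their directions, with a dot for a run of length one. -/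
structure IsRunShape (σ : PegPermutation) (π : Permutation)
    (f : Fin π.length → Fin σ.perm.length) : Prop extends IsPegMap σ π f where
  two_le : ∀ i, σ.peg i ≠ .dot → 2 ≤ blockSize f i
  compact : σ.Compact

theorem two_le_blockSize_iff {n k : ℕ} {f : Fin n → Fin k} {i : Fin k} :
    2 ≤ blockSize f i ↔ ∃ p q, p < q ∧ f p = i ∧ f q = i := by
  rw [blockSize]
  change 1 < (Finset.univ.filter fun p => f p = i).card ↔ _
  rw [Finset.one_lt_card]
  simp only [Finset.mem_filter, Finset.mem_univ, true_and]
  constructor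
  · rintro ⟨p, hp, q, hq, hne⟩
    rcases lt_or_gt_of_ne hne with h | h
    · exact ⟨p, q, h, hp, hq⟩
    · exact ⟨q, p, h, hq, hp⟩
  · rintro ⟨p, q, h, hp, hq⟩
    exact ⟨p, hp, q, hq, h.ne⟩

theorem IsPegMap.blockSize_eq_one {σ : PegPermutation} {π : Permutation} {f}
    (h : IsPegMap σ π f) {i} (hi : σ.peg i = .dot) : blockSize f i = 1 := by
  obtain ⟨p, hp, hu⟩ := h.dot i hi
  refine Finset.card_eq_one.2 ⟨p, ?_⟩
  ext q
  simp only [Finset.mem_filter, Finset.mem_univ, true_and, Finset.mem_singleton]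
  exact ⟨hu q, fun e => e ▸ hp⟩

theorem IsRunShape.surjective {σ : PegPermutation} {π : Permutation} {f}
    (h : IsRunShape σ π f) : Function.Surjective f := fun i => by
  by_cases hi : σ.peg i = .dot
  · exact (h.dot i hi).exists
  · obtain ⟨p, -, -, hp, -⟩ := two_le_blockSize_iff.1 (h.two_le i hi)
    exact ⟨p, hp⟩

/-- Inside a block of a peg map, no point separates two consecutive points. -/
theorem IsPegMap.not_separates {σ : PegPermutation} {π : Permutation} {f}
    (h : IsPegMap σ π f) {p q : Fin π.length} (hpq : (p : ℕ) + 1 = q) (he : f p = f q)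
    (r : Fin π.length) : ¬ Separates π r p q := by
  have hlt : p < q := by rw [Fin.lt_def]; omega
  intro hs
  by_cases hr : f r = f p
  · have hrp : r ≠ p := by
      rintro rfl; rcases hs with hs | hs
      · exact lt_irrefl _ hs.1
      · exact lt_irrefl _ hs.2
    have hrq : r ≠ q := by
      rintro rfl; rcases hs with hs | hs
      · exact lt_irrefl _ hs.2
      · exact lt_irrefl _ hs.1
    have hor : r < p ∨ q < r := by
      rw [Fin.lt_def, Fin.lt_def]
      have := Fin.val_ne_of_ne hrp
      have := Fin.val_ne_of_ne hrq
      omega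
    cases hpeg : σ.peg (f p) with
    | plus =>
      have h1 := h.plus p q hlt he hpeg
      rcases hor with hor | hor
      · have h2 := h.plus r p hor hr (hr ▸ hpeg)
        rcases hs with hs | hs
        · exact lt_asymm hs.1 h2
        · exact lt_asymm (hs.1.trans hs.2) h1
      · have h2 := h.plus q r hor (he.symm.trans hr.symm) (he ▸ hpeg)
        rcases hs with hs | hs
        · exact lt_asymm hs.2 h2
        · exact lt_asymm (hs.1.trans hs.2) h1
    | minus =>
      have h1 := h.minus p q hlt he hpeg
      rcases hor with hor | hor
      · have h2 := h.minus r p hor hr (hr ▸ hpeg)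
        rcases hs with hs | hs
        · exact lt_asymm (hs.1.trans hs.2) h1
        · exact lt_asymm hs.2 h2
      · have h2 := h.minus q r hor (he.symm.trans hr.symm) (he ▸ hpeg)
        rcases hs with hs | hs
        · exact lt_asymm (hs.1.trans hs.2) h1
        · exact lt_asymm hs.1 h2
    | dot => exact hlt.ne ((h.dot _ hpeg).unique rfl he.symm)
  · have hr' : f r ≠ f q := he ▸ hr
    rcases hs with hs | hs
    · have h1 := (h.lt_iff p r (Ne.symm hr)).1 hs.1
      have h2 := (h.lt_iff r q hr').1 hs.2
      rw [he] at h1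
      exact lt_asymm h1 h2
    · have h1 := (h.lt_iff q r (Ne.symm hr')).1 hs.1
      have h2 := (h.lt_iff r p hr).1 hs.2
      rw [he] at h2
      exact lt_asymm h1 h2

/-- A monotone surjective map of positions moves by at most one between consecutive positions. -/
theorem step_of_monotone_surjective {n k : ℕ} {f : Fin n → Fin k} (hf : Monotone f)
    (hs : Function.Surjective f) {p q : Fin n} (hpq : (p : ℕ) + 1 = q) (hne : f p ≠ f q) :
    (f p : ℕ) + 1 = f q := by
  have hlt : f p < f q := lt_of_le_of_ne (hf (by rw [Fin.le_def]; omega)) hne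
  by_contra hn
  rw [Fin.lt_def] at hlt
  obtain ⟨r, hr⟩ := hs ⟨(f p : ℕ) + 1, by have := (f q).2; omega⟩
  rw [Fin.ext_iff] at hr
  rcases lt_or_ge p r with h | h
  · have := hf (show q ≤ r by rw [Fin.le_def]; rw [Fin.lt_def] at h; omega)
    rw [Fin.le_def] at this
    simp only at hr
    omega
  · have := hf h
    rw [Fin.le_def] at this
    simp only at hr
    omega

/-- A compact shape makes the blocks maximal: between consecutive points of different blocks there is a
separating value. -/
theorem IsRunShape.exists_separates {σ : PegPermutation} {π : Permutation} {f}
    (h : IsRunShape σ π f) {p q : Fin π.length} (hpq : (p : ℕ) + 1 = q) (hne : f p ≠ f q) :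
    ∃ r, Separates π r p q := by
  have hstep := step_of_monotone_surjective h.mono h.surjective hpq hne
  have hfp : ∀ x, f x = f p → x ≤ p := fun x hx => by
    by_contra hn
    have := h.mono (show q ≤ x by rw [Fin.le_def]; rw [not_le, Fin.lt_def] at hn; omega)
    rw [hx, Fin.le_def] at this
    omega
  have hfq : ∀ x, f x = f q → q ≤ x := fun x hx => by
    by_contra hn
    have := h.mono (show x ≤ p by rw [Fin.le_def]; rw [not_le, Fin.lt_def] at hn; omega)
    rw [hx, Fin.le_def] at this
    omega
  -- a second point in the block of `p` or of `q`
  have hp2 : σ.peg (f p) ≠ .dot → ∃ x, x < p ∧ f x = f p := fun hd => by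
    obtain ⟨x, y, hxy, hx, hy⟩ := two_le_blockSize_iff.1 (h.two_le _ hd)
    exact ⟨x, lt_of_lt_of_le hxy (hfp y hy), hx⟩
  have hq2 : σ.peg (f q) ≠ .dot → ∃ x, q < x ∧ f x = f q := fun hd => by
    obtain ⟨x, y, hxy, hx, hy⟩ := two_le_blockSize_iff.1 (h.two_le _ hd)
    exact ⟨y, lt_of_le_of_lt (hfq x hx) hxy, hy⟩
  rcases h.compact _ _ hstep with ⟨l, hl⟩ | ⟨hlt, hm⟩ | ⟨hlt, hm⟩
  · obtain ⟨r, rfl⟩ := h.surjective l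
    have h1 : f r ≠ f p := by
      intro e; rw [e] at hl
      rcases hl with hl | hl
      · exact lt_irrefl _ hl.1
      · exact lt_irrefl _ hl.2
    have h2 : f r ≠ f q := by
      intro e; rw [e] at hl
      rcases hl with hl | hl
      · exact lt_irrefl _ hl.2
      · exact lt_irrefl _ hl.1
    exact ⟨r, hl.imp
      (fun hl => ⟨(h.lt_iff _ _ h1.symm).2 hl.1, (h.lt_iff _ _ h2).2 hl.2⟩)
      (fun hl => ⟨(h.lt_iff _ _ h2.symm).2 hl.1, (h.lt_iff _ _ h1).2 hl.2⟩)⟩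
  · rcases hm with hm | hm
    · obtain ⟨x, hx, hfx⟩ := hp2 (by rw [hm]; exact Peg.noConfusion)
      exact ⟨x, Or.inl ⟨h.minus x p hx hfx (hfx ▸ hm),
        (h.lt_iff x q (hfx ▸ hne)).2 (hfx ▸ hlt)⟩⟩
    · obtain ⟨x, hx, hfx⟩ := hq2 (by rw [hm]; exact Peg.noConfusion)
      exact ⟨x, Or.inl ⟨(h.lt_iff p x (hfx ▸ hne)).2 (hfx ▸ hlt),
        h.minus q x hx hfx.symm hm⟩⟩
  · rcases hm with hm | hm
    · obtain ⟨x, hx, hfx⟩ := hp2 (by rw [hm]; exact Peg.noConfusion)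
      exact ⟨x, Or.inr ⟨(h.lt_iff q x (hfx ▸ hne.symm)).2 (hfx ▸ hlt),
        h.plus x p hx hfx (hfx ▸ hm)⟩⟩
    · obtain ⟨x, hx, hfx⟩ := hq2 (by rw [hm]; exact Peg.noConfusion)
      exact ⟨x, Or.inr ⟨h.plus q x hx hfx.symm hm,
        (h.lt_iff x p (hfx ▸ hne.symm)).2 (hfx ▸ hlt)⟩⟩

/-- Blocks change exactly between consecutive points that are separated by some value, so the numbers of
the blocks are determined by the permutation. -/
theorem IsRunShape.val_eq {σ σ' : PegPermutation} {π : Permutation} {f f'}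
    (h : IsRunShape σ π f) (h' : IsRunShape σ' π f') (p : Fin π.length) :
    (f p : ℕ) = f' p := by
  have hzero : ∀ {σ : PegPermutation} {f}, IsRunShape σ π f → ∀ p : Fin π.length,
      (p : ℕ) = 0 → (f p : ℕ) = 0 := fun {σ f} h p hp => by
    obtain ⟨q, hq⟩ := h.surjective ⟨0, (f p).pos⟩
    have := h.mono (show p ≤ q by rw [Fin.le_def]; omega)
    rw [hq, Fin.le_def] at this
    simpa using this
  obtain ⟨p, hp⟩ := p
  induction p with
  | zero => rw [hzero h _ rfl, hzero h' _ rfl]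
  | succ p ih =>
    have ih := ih (by omega)
    have hpq : ((⟨p, by omega⟩ : Fin π.length) : ℕ) + 1 = (⟨p + 1, hp⟩ : Fin π.length) := rfl
    by_cases hs : ∃ r, Separates π r ⟨p, by omega⟩ ⟨p + 1, hp⟩
    · obtain ⟨r, hr⟩ := hs
      rw [← step_of_monotone_surjective h.mono h.surjective hpq
          (fun e => h.not_separates hpq e r hr),
        ← step_of_monotone_surjective h'.mono h'.surjective hpq
          (fun e => h'.not_separates hpq e r hr), ih]
    · have e : f ⟨p, by omega⟩ = f ⟨p + 1, hp⟩ := by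
        by_contra hne
        exact hs (h.exists_separates hpq hne)
      have e' : f' ⟨p, by omega⟩ = f' ⟨p + 1, hp⟩ := by
        by_contra hne
        exact hs (h'.exists_separates hpq hne)
      rw [← e, ← e', ih]

/-- The decorations of a run shape are determined by the permutation and the blocks. -/
theorem IsRunShape.peg_eq {σ : PegPermutation} {peg' : Fin σ.perm.length → Peg} {π : Permutation}
    {f} (h : IsRunShape σ π f) (h' : IsRunShape ⟨σ.perm, peg'⟩ π f) : σ.peg = peg' := by
  funext i
  by_cases hb : 2 ≤ blockSize f i
  · obtain ⟨p, q, hpq, rfl, hq⟩ := two_le_blockSize_iff.1 hb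
    cases h1 : σ.peg (f p) with
    | dot => have := h.blockSize_eq_one h1; omega
    | plus =>
      have a := h.plus p q hpq hq.symm h1
      cases h2 : peg' (f p) with
      | dot => have := h'.blockSize_eq_one h2; omega
      | plus => rfl
      | minus => exact absurd a (lt_asymm (h'.minus p q hpq hq.symm h2))
    | minus =>
      have a := h.minus p q hpq hq.symm h1
      cases h2 : peg' (f p) with
      | dot => have := h'.blockSize_eq_one h2; omega
      | plus => exact absurd a (lt_asymm (h'.plus p q hpq hq.symm h2))
      | minus => rfl
  · have h1 : σ.peg i = .dot := by
      by_contra hd; exact hb (h.two_le i hd)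
    have h2 : peg' i = .dot := by
      by_contra hd; exact hb (h'.two_le i hd)
    rw [h1, h2]

theorem IsRunShape.shape_eq {σ σ' : PegPermutation} {π : Permutation} {f f'}
    (h : IsRunShape σ π f) (h' : IsRunShape σ' π f') : σ = σ' := by
  obtain ⟨⟨k, s⟩, peg⟩ := σ
  obtain ⟨⟨k', s'⟩, peg'⟩ := σ'
  have hk : ∀ {σ σ' : PegPermutation} {f f'} (_ : IsRunShape σ π f) (_ : IsRunShape σ' π f'),
      σ.perm.length ≤ σ'.perm.length := fun {σ σ' f f'} h h' => by
    by_contra hn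
    rw [not_le] at hn
    obtain ⟨p, hp⟩ := h.surjective ⟨_, hn⟩
    have := h.val_eq h' p
    rw [hp] at this
    have := (f' p).2
    simp only at *
    omega
  obtain rfl : k = k' := le_antisymm (hk h h') (hk h' h)
  obtain rfl : f = f' := funext fun p => Fin.ext (h.val_eq h' p)
  obtain rfl : s = s' := by
    refine eq_of_lt_iff fun i j => ?_
    by_cases hij : i = j
    · subst hij
      exact iff_of_false (lt_irrefl _) (lt_irrefl _)
    · obtain ⟨p, rfl⟩ := h.surjective i
      obtain ⟨q, rfl⟩ := h.surjective j
      exact (h.lt_iff p q hij).symm.trans (h'.lt_iff p q hij)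
  obtain rfl : peg = peg' := h.peg_eq h'
  rfl

theorem IsRunShape.map_eq {σ : PegPermutation} {π : Permutation} {f f'}
    (h : IsRunShape σ π f) (h' : IsRunShape σ π f') : f = f' :=
  funext fun p => Fin.ext (h.val_eq h' p)

/-- A point outside of a stretch of positions without run starts compares in the same way with
all points of the stretch. -/
theorem lt_val_iff_of_no_runStart {π : Permutation} {a b r : Fin π.length} (hab : a ≤ b)
    (h : ∀ q, a < q → q ≤ b → ¬ IsRunStart π q) (hr : r < a ∨ b < r) :
    π.val r < π.val a ↔ π.val r < π.val b := by
  obtain ⟨b, hb⟩ := b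
  obtain ⟨a, ha⟩ := a
  rw [Fin.mk_le_mk] at hab
  induction b, hab using Nat.le_induction with
  | base => exact Iff.rfl
  | succ b hab ih =>
    have hrb : r < ⟨a, ha⟩ ∨ (⟨b, by omega⟩ : Fin π.length) < r := hr.imp_right fun h =>
      lt_trans (by rw [Fin.mk_lt_mk]; omega) h
    rw [ih (by omega) (fun q h1 h2 => h q h1 (h2.trans (by rw [Fin.mk_le_mk]; omega))) hrb]
    have hq := h ⟨b + 1, hb⟩ (by rw [Fin.mk_lt_mk]; omega) le_rfl
    rw [IsRunStart] at hq
    push Not at hq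
    obtain ⟨p, hp, hn⟩ := hq
    have hpb : p = ⟨b, by omega⟩ := Fin.ext (by simpa using hp)
    have hn := hn r
    rw [Separates, hpb] at hn
    have h1 : π.val r ≠ π.val ⟨b, by omega⟩ := fun e => by
      have := π.2.injective e
      subst this
      simp only [Fin.mk_lt_mk] at hr hrb
      omega
    have h2 : π.val r ≠ π.val ⟨b + 1, hb⟩ := fun e => by
      have := π.2.injective e
      subst this
      simp only [Fin.mk_lt_mk] at hr hrb
      omega
    constructor
    · intro h3
      by_contra h4
      exact hn (Or.inr ⟨lt_of_le_of_ne (not_lt.1 h4) h2.symm, h3⟩)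
    · intro h3
      by_contra h4
      exact hn (Or.inl ⟨lt_of_le_of_ne (not_lt.1 h4) h1.symm, h3⟩)

theorem val_lt_iff_of_no_runStart {π : Permutation} {a b r : Fin π.length} (hab : a ≤ b)
    (h : ∀ q, a < q → q ≤ b → ¬ IsRunStart π q) (hr : r < a ∨ b < r) :
    π.val a < π.val r ↔ π.val b < π.val r := by
  have h1 : π.val r ≠ π.val a := fun e => by
    have := π.2.injective e
    rw [this] at hr
    exact hr.elim (lt_irrefl _) (not_lt.2 hab)
  have h2 : π.val r ≠ π.val b := fun e => by
    have := π.2.injective e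
    rw [this] at hr
    exact hr.elim (not_lt.2 hab) (lt_irrefl _)
  have := lt_val_iff_of_no_runStart hab h hr
  rw [← not_iff_not, not_lt, not_lt, h1.le_iff_lt, h2.le_iff_lt]
  exact this

/-- Every permutation has a run shape. -/
theorem exists_isRunShape (π : Permutation) :
    ∃ (σ : PegPermutation) (f : _), IsRunShape σ π f ∧
      σ.perm.length = (runStarts π).card := by
  classical
  set L := runStarts π with hL
  let s : Fin L.card → Fin π.length := fun i => L.orderIsoOfFin rfl i
  have hs : StrictMono s := fun _ _ h => (L.orderIsoOfFin rfl).strictMono h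
  have hsL : ∀ i, IsRunStart π (s i) := fun i => mem_runStarts.1 (L.orderIsoOfFin rfl i).2
  have hsurj : ∀ q, IsRunStart π q → ∃ i, s i = q := fun q hq =>
    ⟨(L.orderIsoOfFin rfl).symm ⟨q, mem_runStarts.2 hq⟩,
      congrArg Subtype.val (OrderIso.apply_symm_apply _ _)⟩
  have hex : ∀ p, ∃ i, s i ≤ p ∧ ∀ q, s i < q → q ≤ p → ¬ IsRunStart π q := fun p => by
    have hne : (Finset.univ.filter fun q => IsRunStart π q ∧ q ≤ p).Nonempty := by
      refine ⟨⟨0, p.pos⟩, ?_⟩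
      simp only [Finset.mem_filter, Finset.mem_univ, true_and]
      exact ⟨fun r hr => by simp at hr, by rw [Fin.le_def]; simp⟩
    obtain ⟨q, hq, hmax⟩ := Finset.exists_max_image _ id hne
    simp only [Finset.mem_filter, Finset.mem_univ, true_and, id] at hq hmax
    obtain ⟨i, rfl⟩ := hsurj q hq.1
    exact ⟨i, hq.2, fun r h1 h2 h3 => not_lt.2 (hmax r ⟨h3, h2⟩) h1⟩
  choose f hf1 hf2 using hex
  have hlt : ∀ p j, f p < j → p < s j := fun p j h => by
    by_contra hn
    exact hf2 p (s j) (hs h) (not_lt.1 hn) (hsL j)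
  have hmono : Monotone f := fun p q hpq => by
    by_contra hn
    exact absurd (hlt q (f p) (not_le.1 hn)) (not_lt.2 ((hf1 p).trans hpq))
  have hfs : ∀ i, f (s i) = i := fun i => by
    refine le_antisymm (hs.le_iff_le.1 (hf1 _)) ?_
    by_contra hn
    exact lt_irrefl _ (hlt _ _ (not_le.1 hn))
  have hblock : ∀ a b, a ≤ b → f a = f b → ∀ q, a < q → q ≤ b → ¬ IsRunStart π q :=
    fun a b hab he q h1 h2 => hf2 b q (lt_of_le_of_lt (he ▸ hf1 a) h1) h2
  let peg : Fin L.card → Peg := fun i => if blockSize f i < 2 then .dot else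
    if ∃ q, f q = i ∧ s i < q ∧ π.val (s i) < π.val q then .plus else .minus
  have hcmp : ∀ p q, f p < f q → (π.val p < π.val q ↔ π.val (s (f p)) < π.val (s (f q))) ∧
      (π.val q < π.val p ↔ π.val (s (f q)) < π.val (s (f p))) := fun p q h => by
    have h1 := hlt p _ h
    have hq := hblock (s (f q)) q (hf1 q) (hfs _)
    have hp := hblock (s (f p)) p (hf1 p) (hfs _)
    exact ⟨(lt_val_iff_of_no_runStart (hf1 q) hq (Or.inl h1)).symm.trans
        (val_lt_iff_of_no_runStart (hf1 p) hp (Or.inr h1)).symm,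
      (val_lt_iff_of_no_runStart (hf1 q) hq (Or.inl h1)).symm.trans
        (lt_val_iff_of_no_runStart (hf1 p) hp (Or.inr h1)).symm⟩
  have hin : ∀ p q, p < q → f p = f q → (π.val p < π.val q ↔ π.val (s (f p)) < π.val q) :=
    fun p q hpq _ => (val_lt_iff_of_no_runStart (hf1 p)
      (hblock (s (f p)) p (hf1 p) (hfs _)) (Or.inr hpq)).symm
  have hin' : ∀ a b, a ≤ b → f a = f b → s (f a) < a →
      (π.val (s (f a)) < π.val a ↔ π.val (s (f a)) < π.val b) := fun a b hab he hsa =>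
    lt_val_iff_of_no_runStart hab (hblock a b hab he) (Or.inl hsa)
  have hM : IsPegMap ⟨π.restrict L, peg⟩ π f := by
    refine ⟨hmono, fun p q hne => ?_, fun p q hpq he hp => ?_, fun p q hpq he hp => ?_,
      fun i hi => ?_⟩
    · refine Iff.trans ?_ (π.restrict_val_lt_iff L (f p) (f q)).symm
      rcases lt_or_gt_of_ne hne with h | h
      · exact (hcmp p q h).1
      · exact (hcmp q p h).2
    · change peg (f p) = .plus at hp
      simp only [peg] at hp
      split_ifs at hp with h1 h2
      obtain ⟨q0, hq0, h3, h4⟩ := h2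
      rw [hin p q hpq he]
      have hsq : s (f p) < q := lt_of_le_of_lt (hf1 p) hpq
      rcases le_total q0 q with h | h
      · have := hin' q0 q h (hq0.trans he) (hq0 ▸ h3)
        rw [hq0] at this
        exact this.1 h4
      · have := hin' q q0 h (he.symm.trans hq0.symm) (he ▸ hsq)
        rw [← he] at this
        exact this.2 h4
    · change peg (f p) = .minus at hp
      simp only [peg] at hp
      split_ifs at hp with h1 h2
      have hsq : s (f p) < q := lt_of_le_of_lt (hf1 p) hpq
      have hn : ¬ π.val p < π.val q := fun h =>
        h2 ⟨q, he.symm, hsq, (hin p q hpq he).1 h⟩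
      exact lt_of_le_of_ne (not_lt.1 hn) fun e => hpq.ne' (π.2.injective e)
    · change Fin L.card at i
      change peg i = .dot at hi
      refine ⟨s i, hfs i, fun q hq => ?_⟩
      by_contra hne
      have h2 : 2 ≤ blockSize f i := by
        rcases lt_or_gt_of_ne hne with h | h
        · exact two_le_blockSize_iff.2 ⟨q, s i, h, hq, hfs i⟩
        · exact two_le_blockSize_iff.2 ⟨s i, q, h, hfs i, hq⟩
      simp only [peg] at hi
      split_ifs at hi with h1
      omega
  refine ⟨⟨π.restrict L, peg⟩, f, ⟨hM, fun i hi => ?_, ?_⟩, rfl⟩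
  · by_contra hn
    exact hi (if_pos (not_le.1 hn))
  · intro i j hij
    change Fin L.card at i j
    have hij' : i < j := by rw [Fin.lt_def]; omega
    have hq : f (s j) = j := hfs j
    have hpos : (s i : ℕ) < s j := hs hij'
    set q := s j with hqdef
    obtain ⟨p, hpq⟩ : ∃ p : Fin π.length, (p : ℕ) + 1 = q := ⟨⟨q - 1, by omega⟩, by simp; omega⟩
    have hlast : ∀ x, x < q → x ≤ p := fun x hx => by rw [Fin.lt_def] at hx; rw [Fin.le_def]; omega
    have hp : f p = i := by
      have h1 := hmono (hlast (s i) hpos)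
      rw [hfs] at h1
      refine le_antisymm ?_ h1
      by_contra hn
      rw [not_le] at hn
      have h2 := hs.monotone (show j ≤ f p by rw [Fin.le_def]; rw [Fin.lt_def] at hn; omega)
      have h3 := h2.trans (hf1 p)
      rw [← hqdef, Fin.le_def] at h3
      omega
    have hne : f p ≠ f q := by rw [hp, hq]; exact hij'.ne
    obtain ⟨r, hr⟩ := hsL j p hpq
    subst hp
    have hrp : r ≠ p := by
      rintro rfl; rcases hr with hs | hs
      · exact lt_irrefl _ hs.1
      · exact lt_irrefl _ hs.2
    have hrq : r ≠ q := by
      rintro rfl; rcases hr with hs | hs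
      · exact lt_irrefl _ hs.2
      · exact lt_irrefl _ hs.1
    have hpq' := hM.lt_iff p q hne
    have hqp' := hM.lt_iff q p hne.symm
    by_cases h1 : f r = f p
    · have hlt' : r < p := by
        have : r < q := by
          by_contra hn
          have := hmono (not_lt.1 hn)
          rw [h1, hq] at this
          exact absurd hij' (not_lt.2 this)
        exact lt_of_le_of_ne (hlast r this) hrp
      rcases hr with hr | hr
      · refine Or.inr (Or.inl ⟨hq ▸ hpq'.1 (hr.1.trans hr.2), Or.inl ?_⟩)
        cases hpeg : peg (f p) with
        | plus => exact absurd hr.1 (lt_asymm (hM.plus r p hlt' h1 (h1 ▸ hpeg)))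
        | minus => exact hpeg
        | dot => exact absurd ((hM.dot _ hpeg).unique h1 rfl) hrp
      · refine Or.inr (Or.inr ⟨hq ▸ hqp'.1 (hr.1.trans hr.2), Or.inl ?_⟩)
        cases hpeg : peg (f p) with
        | plus => exact hpeg
        | minus => exact absurd hr.2 (lt_asymm (hM.minus r p hlt' h1 (h1 ▸ hpeg)))
        | dot => exact absurd ((hM.dot _ hpeg).unique h1 rfl) hrp
    by_cases h2 : f r = f q
    · have hlt' : q < r := by
        refine lt_of_le_of_ne ?_ hrq.symm
        have := hf1 r
        rwa [h2, hq] at this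
      rcases hr with hr | hr
      · refine Or.inr (Or.inl ⟨hq ▸ hpq'.1 (hr.1.trans hr.2), Or.inr ?_⟩)
        cases hpeg : peg (f q) with
        | plus => exact absurd hr.2 (lt_asymm (hM.plus q r hlt' h2.symm hpeg))
        | minus => exact hq ▸ hpeg
        | dot => exact absurd ((hM.dot _ hpeg).unique h2 rfl) hrq
      · refine Or.inr (Or.inr ⟨hq ▸ hqp'.1 (hr.1.trans hr.2), Or.inr ?_⟩)
        cases hpeg : peg (f q) with
        | plus => exact hq ▸ hpeg
        | minus => exact absurd hr.1 (lt_asymm (hM.minus q r hlt' h2.symm hpeg))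
        | dot => exact absurd ((hM.dot _ hpeg).unique h2 rfl) hrq
    · refine Or.inl ⟨f r, ?_⟩
      rw [← hq]
      exact hr.imp
        (fun hr => ⟨(hM.lt_iff _ _ (Ne.symm h1)).1 hr.1, (hM.lt_iff _ _ h2).1 hr.2⟩)
        (fun hr => ⟨(hM.lt_iff _ _ (Ne.symm h2)).1 hr.1, (hM.lt_iff _ _ h1).1 hr.2⟩)

/-! ### Few patterns force few runs -/

/-- A digraph with out-degrees at most `d` has an independent set that contains at least a
fraction `1 / (2 * d + 1)` of the vertices. -/
theorem exists_independent_of_outdegree_le {α : Type*} [DecidableEq α] (r : α → α → Prop)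
    [DecidableRel r] (d : ℕ) (V : Finset α) (h : ∀ k ∈ V, (V.filter (r k)).card ≤ d) :
    ∃ J ⊆ V, V.card ≤ (2 * d + 1) * J.card ∧ ∀ k ∈ J, ∀ j ∈ J, k ≠ j → ¬ r k j := by
  induction V using Finset.strongInduction with
  | H V ih =>
    rcases V.eq_empty_or_nonempty with rfl | hV
    · exact ⟨∅, le_rfl, by simp, by simp⟩
    -- the average in-degree equals the average out-degree
    obtain ⟨v, hv, hin⟩ : ∃ v ∈ V, (V.filter (r · v)).card ≤ d := by
      refine Finset.exists_le_of_sum_le (g := fun _ => d) hV ?_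
      have := Finset.sum_card_bipartiteAbove_eq_sum_card_bipartiteBelow (s := V) (t := V) r
      simp only [Finset.bipartiteAbove, Finset.bipartiteBelow] at this
      rw [← this]
      exact Finset.sum_le_sum h
    set V' := V.filter fun x => x ≠ v ∧ ¬ r v x ∧ ¬ r x v with hV'
    have hsub : V' ⊂ V := by
      refine (Finset.filter_subset _ _).ssubset_of_ne fun e => ?_
      have := e ▸ hv
      simp at this
    obtain ⟨J, hJ, hcard, hind⟩ := ih V' hsub fun k hk =>
      (Finset.card_le_card (Finset.filter_subset_filter _ hsub.subset)).trans (h k (hsub.subset hk))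
    have hJv : ∀ j ∈ J, j ≠ v ∧ ¬ r v j ∧ ¬ r j v := fun j hj => (Finset.mem_filter.1 (hJ hj)).2
    refine ⟨insert v J, Finset.insert_subset hv (hJ.trans hsub.subset), ?_, ?_⟩
    · have hcov : V ⊆ V' ∪ ({v} ∪ (V.filter (r v) ∪ V.filter (r · v))) := fun x hx => by
        simp only [V', Finset.mem_union, Finset.mem_filter, Finset.mem_singleton]
        tauto
      have h1 := (Finset.card_le_card hcov).trans (Finset.card_union_le _ _)
      have h2 := Finset.card_union_le {v} (V.filter (r v) ∪ V.filter (r · v))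
      have h3 := Finset.card_union_le (V.filter (r v)) (V.filter (r · v))
      have h4 := h v hv
      rw [Finset.card_singleton] at h2
      rw [Finset.card_insert_of_notMem fun hvJ => (hJv v hvJ).1 rfl]
      linarith [mul_add (2 * d + 1) J.card 1]
    · intro k hk j hj hkj
      rcases Finset.mem_insert.1 hk with rfl | hk
      · exact (hJv j ((Finset.mem_insert.1 hj).resolve_left hkj.symm)).2.1
      · rcases Finset.mem_insert.1 hj with e | hj
        · exact e ▸ (hJv k hk).2.2
        · exact hind k hk j hj hkj

theorem card_filter_lt_orderIso {α : Type*} [LinearOrder α] {S T : Finset α} (φ : S ≃o T) (x : S) :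
    (S.filter (· < (x : α))).card = (T.filter (· < (φ x : α))).card := by
  refine Finset.card_bij' (fun y hy => (φ ⟨y, (Finset.mem_filter.1 hy).1⟩ : α))
    (fun y hy => (φ.symm ⟨y, (Finset.mem_filter.1 hy).1⟩ : α)) ?_ ?_ ?_ ?_
  · intro y hy
    rw [Finset.mem_filter] at hy ⊢
    exact ⟨(φ _).2, φ.strictMono hy.2⟩
  · intro y hy
    rw [Finset.mem_filter] at hy ⊢
    exact ⟨(φ.symm _).2, by simpa using φ.symm.strictMono (show (⟨y, hy.1⟩ : T) < φ x from hy.2)⟩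
  · intro y hy; simp
  · intro y hy; simp

theorem card_filter_gt_orderIso {α : Type*} [LinearOrder α] {S T : Finset α} (φ : S ≃o T) (x : S) :
    (S.filter ((x : α) < ·)).card = (T.filter ((φ x : α) < ·)).card := by
  refine Finset.card_bij' (fun y hy => (φ ⟨y, (Finset.mem_filter.1 hy).1⟩ : α))
    (fun y hy => (φ.symm ⟨y, (Finset.mem_filter.1 hy).1⟩ : α)) ?_ ?_ ?_ ?_
  · intro y hy
    rw [Finset.mem_filter] at hy ⊢
    exact ⟨(φ _).2, φ.strictMono hy.2⟩
  · intro y hy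
    rw [Finset.mem_filter] at hy ⊢
    exact ⟨(φ.symm _).2, by simpa using φ.symm.strictMono (show φ x < (⟨y, hy.1⟩ : T) from hy.2)⟩
  · intro y hy; simp
  · intro y hy; simp

theorem eq_of_card_filter_lt_eq {α : Type*} [LinearOrder α] {T : Finset α} {x y : α}
    (hx : x ∈ T) (hy : y ∈ T) (h : (T.filter (· < x)).card = (T.filter (· < y)).card) : x = y := by
  have key : ∀ {x y}, x ∈ T → x < y → (T.filter (· < x)).card < (T.filter (· < y)).card :=
    fun {x y} hx hxy => Finset.card_lt_card <| Finset.ssubset_iff_subset_ne.2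
      ⟨Finset.monotone_filter_right _ fun z _ hz => lt_trans hz hxy, fun e => by
        have : x ∈ T.filter (· < y) := Finset.mem_filter.2 ⟨hx, hxy⟩
        rw [← e] at this
        exact lt_irrefl _ (Finset.mem_filter.1 this).2⟩
  rcases lt_trichotomy x y with hxy | e | hxy
  · exact absurd h (key hx hxy).ne
  · exact e
  · exact absurd h (key hy hxy).ne'

theorem eq_of_card_filter_gt_eq {α : Type*} [LinearOrder α] {T : Finset α} {x y : α}
    (hx : x ∈ T) (hy : y ∈ T) (h : (T.filter (x < ·)).card = (T.filter (y < ·)).card) : x = y :=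
  eq_of_card_filter_lt_eq (α := αᵒᵈ) hx hy h

/-- An order isomorphism between two finite sets that are indexed compatibly with their orders
preserves the indices. -/
theorem orderIso_apply_of_index {ι α : Type*} [LinearOrder α] {I : Finset ι}
    {e e' : ι → α} {r : ι → ι → Prop} (he : Set.InjOn e I) (he' : Set.InjOn e' I)
    (hr : ∀ i ∈ I, ∀ j ∈ I, e i < e j ↔ r i j) (hr' : ∀ i ∈ I, ∀ j ∈ I, e' i < e' j ↔ r i j)
    (φ : I.image e ≃o I.image e') {i : ι} (hi : i ∈ I) :
    (φ ⟨e i, Finset.mem_image_of_mem e hi⟩ : α) = e' i := by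
  classical
  have key : ∀ {e : ι → α}, Set.InjOn e I → (∀ i ∈ I, ∀ j ∈ I, e i < e j ↔ r i j) →
      ((I.image e).filter (· < e i)).card = (I.filter (r · i)).card := fun {e} he hr => by
    rw [Finset.filter_image, Finset.card_image_of_injOn
      (he.mono (Finset.coe_subset.2 (Finset.filter_subset _ _)))]
    exact congrArg _ (Finset.filter_congr fun j hj => hr j hj i hi)
  refine eq_of_card_filter_lt_eq (φ _).2 (Finset.mem_image_of_mem e' hi) ?_
  rw [← card_filter_lt_orderIso, key he' hr', ← key he hr]

theorem mem_of_contains {C : Set Permutation} (hC : IsPermClass C) {π p : Permutation}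
    (hπ : π ∈ C) (h : π.Contains p) : p ∈ C :=
  hC ▸ ⟨π, hπ, h⟩

theorem finite_length_le (C : Set Permutation) (N : ℕ) :
    {π ∈ C | π.length ≤ N}.Finite := by
  have : (⋃ n ∈ Finset.range (N + 1),
      Set.range fun σ : Equiv.Perm (Fin n) => (⟨n, σ⟩ : Permutation)).Finite :=
    Set.Finite.biUnion (Finset.finite_toSet _) fun n _ => Set.finite_range _
  refine this.subset fun π hπ => ?_
  simp only [Set.mem_iUnion]
  exact ⟨π.1, Finset.mem_range.2 (Nat.lt_succ_of_le hπ.2), π.2, rfl⟩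

theorem two_pow_le_ncard_of_injOn {C : Set Permutation} (hC : IsPermClass C) {π : Permutation}
    (hπ : π ∈ C) {α : Type*} (Q : Finset α) (S : Finset α → Finset (Fin π.length)) {N : ℕ}
    (hS : ∀ W ⊆ Q, (S W).card ≤ N)
    (hinj : ∀ W ⊆ Q, ∀ W' ⊆ Q, π.restrict (S W) = π.restrict (S W') → W = W') :
    2 ^ Q.card ≤ {π ∈ C | π.length ≤ N}.ncard := by
  have h1 : ((fun W => π.restrict (S W)) '' (Q.powerset : Set (Finset α))).ncard = 2 ^ Q.card := by
    rw [Set.InjOn.ncard_image, Set.ncard_coe_finset, Finset.card_powerset]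
    intro W hW W' hW' h
    exact hinj W (Finset.mem_powerset.1 hW) W' (Finset.mem_powerset.1 hW') h
  rw [← h1]
  refine Set.ncard_le_ncard ?_ (finite_length_le C N)
  rintro _ ⟨W, hW, rfl⟩
  exact ⟨mem_of_contains hC hπ (contains_restrict _ _), hS W (Finset.mem_powerset.1 hW)⟩

theorem Separates.ne_left {π : Permutation} {r p q : Fin π.length} (h : Separates π r p q) :
    r ≠ p := by
  rintro rfl; rcases h with h | h
  · exact lt_irrefl _ h.1
  · exact lt_irrefl _ h.2

theorem Separates.ne_right {π : Permutation} {r p q : Fin π.length} (h : Separates π r p q) :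
    r ≠ q := by
  rintro rfl; rcases h with h | h
  · exact lt_irrefl _ h.2
  · exact lt_irrefl _ h.1

/-- If one point `v` separates many pairs of consecutive points, then `v` together with one point
of each pair forms many different patterns: whether the point chosen from a pair lies above or
below `v` can be read off the pattern. -/
theorem two_pow_le_of_common_separator {C : Set Permutation} (hC : IsPermClass C)
    {π : Permutation} (hπ : π ∈ C) (Q : Finset (Fin π.length)) (p : Fin π.length → Fin π.length)
    (hp : ∀ q ∈ Q, (p q : ℕ) + 1 = q) (hQ : ∀ q ∈ Q, ∀ q' ∈ Q, q < q' → q < p q')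
    (v : Fin π.length) (hv : ∀ q ∈ Q, Separates π v (p q) q) :
    2 ^ Q.card ≤ {π ∈ C | π.length ≤ Q.card + 1}.ncard := by
  classical
  -- from the pair of `q`, the point above `v` is chosen if `q ∈ W`, the point below `v` otherwise
  let u : Finset (Fin π.length) → Fin π.length → Fin π.length := fun W q =>
    if (q ∈ W ↔ π.val v < π.val q) then q else p q
  have hu : ∀ W q, u W q = q ∨ u W q = p q := fun W q => by
    simp only [u]; split_ifs <;> simp
  have hple : ∀ q ∈ Q, p q < q := fun q hq => by rw [Fin.lt_def]; have := hp q hq; omega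
  have hu1 : ∀ W, ∀ q ∈ Q, p q ≤ u W q ∧ u W q ≤ q := fun W q hq => by
    rcases hu W q with h | h <;> rw [h]
    · exact ⟨(hple q hq).le, le_rfl⟩
    · exact ⟨le_rfl, (hple q hq).le⟩
  have huv : ∀ W, ∀ q ∈ Q, (v < u W q ↔ v < q) ∧ (u W q < v ↔ q < v) := fun W q hq => by
    have h1 := Fin.val_ne_of_ne (hv q hq).ne_left
    have h2 := Fin.val_ne_of_ne (hv q hq).ne_right
    have h3 := hp q hq
    rcases hu W q with h | h <;> rw [h]
    · exact ⟨Iff.rfl, Iff.rfl⟩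
    · simp only [Fin.lt_def]
      omega
  have huu : ∀ W, ∀ q ∈ Q, ∀ q' ∈ Q, u W q < u W q' ↔ q < q' := fun W q hq q' hq' => by
    have key : ∀ q ∈ Q, ∀ q' ∈ Q, q < q' → u W q < u W q' := fun q hq q' hq' h =>
      lt_of_le_of_lt (hu1 W q hq).2 (lt_of_lt_of_le (hQ q hq q' hq' h) (hu1 W q' hq').1)
    refine ⟨fun h => ?_, key q hq q' hq'⟩
    by_contra hn
    rcases (not_lt.1 hn).lt_or_eq with h' | rfl
    · exact lt_asymm h (key q' hq' q hq h')
    · exact lt_irrefl _ h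
  have hval : ∀ W, ∀ q ∈ Q, π.val v < π.val (u W q) ↔ q ∈ W := fun W q hq => by
    simp only [u]
    rcases hv q hq with h | h
    · have := lt_asymm h.1
      by_cases hW : q ∈ W <;> simp [hW, h.2, this]
    · have := lt_asymm h.1
      by_cases hW : q ∈ W <;> simp [hW, h.2, this]
  let e : Finset (Fin π.length) → Option (Fin π.length) → Fin π.length := fun W x =>
    x.elim v (u W)
  let r : Option (Fin π.length) → Option (Fin π.length) → Prop := fun x y =>
    x.elim v id < y.elim v id
  have hmem : ∀ x ∈ Finset.insertNone Q, x = none ∨ ∃ q ∈ Q, x = some q := by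
    intro x hx
    cases x with
    | none => exact Or.inl rfl
    | some q => exact Or.inr ⟨q, by simpa using hx, rfl⟩
  have hr : ∀ W, ∀ x ∈ Finset.insertNone Q, ∀ y ∈ Finset.insertNone Q,
      e W x < e W y ↔ r x y := by
    intro W x hx y hy
    rcases hmem x hx with rfl | ⟨q, hq, rfl⟩ <;> rcases hmem y hy with rfl | ⟨q', hq', rfl⟩
    · exact Iff.rfl
    · exact (huv W q' hq').1
    · exact (huv W q hq).2
    · exact huu W q hq q' hq'
  have hinj : ∀ W, Set.InjOn (e W) (Finset.insertNone Q) := by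
    intro W x hx y hy hxy
    have h1 : ¬ r x y := fun h => ((hr W x hx y hy).2 h).ne hxy
    have h2 : ¬ r y x := fun h => ((hr W y hy x hx).2 h).ne' hxy
    have h3 := le_antisymm (not_lt.1 h2) (not_lt.1 h1)
    rcases hmem x hx with rfl | ⟨q, hq, rfl⟩ <;> rcases hmem y hy with rfl | ⟨q', hq', rfl⟩
    · rfl
    · exact absurd h3 (hv q' hq').ne_right
    · exact absurd h3.symm (hv q hq).ne_right
    · exact congrArg some h3
  refine two_pow_le_ncard_of_injOn hC hπ Q (fun W => (Finset.insertNone Q).image (e W))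
    (fun W _ => Finset.card_image_le.trans (by simp)) fun W hW W' hW' h => ?_
  obtain ⟨φ, hφ⟩ := exists_orderIso_of_restrict_eq h
  have hφe : ∀ x (hx : x ∈ Finset.insertNone Q),
      (φ ⟨e W x, Finset.mem_image_of_mem _ hx⟩ : Fin π.length) = e W' x := fun x hx =>
    orderIso_apply_of_index (hinj W) (hinj W') (hr W) (hr W') φ hx
  have hWW' : ∀ q ∈ Q, q ∈ W ↔ q ∈ W' := fun q hq => by
    have h0 : none ∈ Finset.insertNone Q := by simp
    have h1 : some q ∈ Finset.insertNone Q := by simpa using hq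
    have := hφ ⟨e W none, Finset.mem_image_of_mem _ h0⟩ ⟨e W (some q), Finset.mem_image_of_mem _ h1⟩
    rw [hφe _ h0, hφe _ h1] at this
    exact (hval W q hq).symm.trans (this.trans (hval W' q hq))
  ext q
  exact ⟨fun hq => (hWW' q (hW hq)).1 hq, fun hq => (hWW' q (hW' hq)).2 hq⟩

/-- If many disjoint pairs of consecutive points have separators that separate no other pair, then
the pairs together with an arbitrary set of separators form many different patterns: reading from
one end, each pair can be located once it is known which separators precede it, and then it can be
seen whether it is separated. -/
theorem two_pow_le_of_private_separators {C : Set Permutation} (hC : IsPermClass C)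
    {π : Permutation} (hπ : π ∈ C) (J : Finset (Fin π.length)) (p w : Fin π.length → Fin π.length)
    (hp : ∀ q ∈ J, (p q : ℕ) + 1 = q) (hw : ∀ q ∈ J, Separates π (w q) (p q) q)
    (hind : ∀ k ∈ J, ∀ j ∈ J, k ≠ j → ¬ (Separates π (p k) (p j) j ∨ Separates π k (p j) j ∨
      Separates π (w k) (p j) j))
    (hside : (∀ q ∈ J, q < w q) ∨ ∀ q ∈ J, w q < p q) :
    2 ^ J.card ≤ {π ∈ C | π.length ≤ 3 * J.card}.ncard := by
  classical
  let S : Finset (Fin π.length) → Finset (Fin π.length) := fun W => J ∪ (J.image p ∪ W.image w)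
  have hmem : ∀ W y, y ∈ S W ↔ y ∈ J ∨ (∃ k ∈ J, p k = y) ∨ ∃ k ∈ W, w k = y := fun W y => by
    simp [S]
  have hple : ∀ q ∈ J, p q < q := fun q hq => by rw [Fin.lt_def]; have := hp q hq; omega
  -- if two patterns agree as far as the pair `i`, that pair is matched with itself, so that a separator
  -- of it in the first pattern is matched with one in the second
  have core : ∀ W ⊆ J, ∀ W' ⊆ J, ∀ i ∈ W, i ∉ W' →
      ((∀ y, y < i → (y ∈ S W ↔ y ∈ S W')) ∨ ∀ y, p i < y → (y ∈ S W ↔ y ∈ S W')) →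
      π.restrict (S W) ≠ π.restrict (S W') := by
    intro W hW W' hW' i hi hi' hag h
    obtain ⟨φ, hφ⟩ := exists_orderIso_of_restrict_eq h
    have hiJ := hW hi
    have hiS : ∀ W, i ∈ S W := fun W => (hmem W i).2 (Or.inl hiJ)
    have hpS : ∀ W, p i ∈ S W := fun W => (hmem W _).2 (Or.inr (Or.inl ⟨i, hiJ, rfl⟩))
    have hfix : ∀ x (hx : x ∈ S W), x ∈ S W' → (x = p i ∨ x = i) →
        (φ ⟨x, hx⟩ : Fin π.length) = x := by
      intro x hx hx' hxi
      rcases hag with hag | hag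
      · refine eq_of_card_filter_lt_eq (φ _).2 hx' ?_
        rw [← card_filter_lt_orderIso]
        congr 1
        ext y
        simp only [Finset.mem_filter, and_congr_left_iff]
        intro hy
        refine hag y (lt_of_lt_of_le hy ?_)
        rcases hxi with rfl | rfl
        · exact (hple i hiJ).le
        · exact le_rfl
      · refine eq_of_card_filter_gt_eq (φ _).2 hx' ?_
        rw [← card_filter_gt_orderIso]
        congr 1
        ext y
        simp only [Finset.mem_filter, and_congr_left_iff]
        intro hy
        refine hag y (lt_of_le_of_lt ?_ hy)
        rcases hxi with rfl | rfl
        · exact le_rfl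
        · exact (hple _ hiJ).le
    have hwS : w i ∈ S W := (hmem W _).2 (Or.inr (Or.inr ⟨i, hi, rfl⟩))
    have hsep : Separates π (φ ⟨w i, hwS⟩) (p i) i := by
      have h1 := hφ ⟨p i, hpS W⟩ ⟨w i, hwS⟩
      have h2 := hφ ⟨w i, hwS⟩ ⟨i, hiS W⟩
      have h3 := hφ ⟨i, hiS W⟩ ⟨w i, hwS⟩
      have h4 := hφ ⟨w i, hwS⟩ ⟨p i, hpS W⟩
      rw [hfix _ (hpS W) (hpS W') (Or.inl rfl)] at h1 h4
      rw [hfix _ (hiS W) (hiS W') (Or.inr rfl)] at h2 h3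
      exact (hw i hiJ).imp (fun h => ⟨h1.1 h.1, h2.1 h.2⟩) fun h => ⟨h3.1 h.1, h4.1 h.2⟩
    rcases (hmem W' _).1 (φ ⟨w i, hwS⟩).2 with hJ | ⟨k, hk, hJ⟩ | ⟨k, hk, hJ⟩
    · exact hind _ hJ i hiJ hsep.ne_right (Or.inr (Or.inl hsep))
    · rw [← hJ] at hsep
      exact hind k hk i hiJ (fun e => hsep.ne_left (e ▸ rfl)) (Or.inl hsep)
    · rw [← hJ] at hsep
      exact hind k (hW' hk) i hiJ (fun e => hi' (e ▸ hk)) (Or.inr (Or.inr hsep))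
  refine two_pow_le_ncard_of_injOn hC hπ J S (fun W hW => ?_) fun W hW W' hW' h => ?_
  · have h1 := Finset.card_union_le J (J.image p ∪ W.image w)
    have h2 := Finset.card_union_le (J.image p) (W.image w)
    have h3 := Finset.card_image_le (s := J) (f := p)
    have h4 := (Finset.card_image_le (s := W) (f := w)).trans (Finset.card_le_card hW)
    change (J ∪ (J.image p ∪ W.image w)).card ≤ _
    omega
  · by_contra hne
    have hD : (symmDiff W W').Nonempty := by
      rw [Finset.nonempty_iff_ne_empty]
      exact fun e => hne (symmDiff_eq_bot.1 e)
    have hS : ∀ y, (∀ k ∈ J, w k = y → k ∉ symmDiff W W') → (y ∈ S W ↔ y ∈ S W') := by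
      intro y hy
      have hiff : ∀ k ∈ J, w k = y → (k ∈ W ↔ k ∈ W') := fun k hk e => by
        have := hy k hk e
        rw [Finset.mem_symmDiff] at this
        tauto
      rw [hmem, hmem]
      refine or_congr Iff.rfl (or_congr Iff.rfl ⟨?_, ?_⟩)
      · rintro ⟨k, hk, e⟩
        exact ⟨k, (hiff k (hW hk) e).1 hk, e⟩
      · rintro ⟨k, hk, e⟩
        exact ⟨k, (hiff k (hW' hk) e).2 hk, e⟩
    obtain ⟨i, hi, hag⟩ : ∃ i ∈ symmDiff W W',
        (∀ y, y < i → (y ∈ S W ↔ y ∈ S W')) ∨ ∀ y, p i < y → (y ∈ S W ↔ y ∈ S W') := by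
      rcases hside with hside | hside
      · obtain ⟨i, hi, hmin⟩ := Finset.exists_min_image _ id hD
        refine ⟨i, hi, Or.inl fun y hy => hS y fun k hk e hkD => ?_⟩
        have := (hside k hk).trans (e.trans_lt hy)
        exact absurd (hmin k hkD) (not_le.2 this)
      · obtain ⟨i, hi, hmax⟩ := Finset.exists_max_image _ id hD
        have hiJ : i ∈ J := (Finset.mem_symmDiff.1 hi).elim (fun h => hW h.1) fun h => hW' h.1
        refine ⟨i, hi, Or.inr fun y hy => hS y fun k hk e hkD => ?_⟩
        have h1 := hy.trans_le (e.symm.le.trans (hside k hk).le)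
        have h2 := hmax k hkD
        have h3 := hp i hiJ
        have h4 := hp k hk
        simp only [id, Fin.le_def, Fin.lt_def] at h1 h2
        omega
    rcases Finset.mem_symmDiff.1 hi with ⟨h1, h2⟩ | ⟨h1, h2⟩
    · exact core W hW W' hW' i h1 h2 hag h
    · exact core W' hW' W hW i h1 h2
        (hag.imp (fun h y hy => (h y hy).symm) fun h y hy => (h y hy).symm) h.symm

/-- If a class has fewer than `2 ^ m` members of length at most `3 * m + 1`, then the number of runs
of its members is bounded. -/
theorem card_runStarts_le {C : Set Permutation} (hC : IsPermClass C) {m : ℕ}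
    (hm : {π ∈ C | π.length ≤ 3 * m + 1}.ncard < 2 ^ m) {π : Permutation} (hπ : π ∈ C) :
    (runStarts π).card ≤ 4 * m * (6 * m + 1) + 1 := by
  classical
  by_contra hn
  have hmono : ∀ N, N ≤ 3 * m + 1 → {π ∈ C | π.length ≤ N}.ncard < 2 ^ m := fun N hN =>
    lt_of_le_of_lt (Set.ncard_le_ncard (by rintro π ⟨h1, h2⟩; exact ⟨h1, h2.trans hN⟩)
      (finite_length_le C _)) hm
  let p : Fin π.length → Fin π.length := fun q => ⟨q - 1, by omega⟩
  let L := (runStarts π).filter fun q : Fin π.length => (q : ℕ) ≠ 0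
  have hL : (runStarts π).card ≤ L.card + 1 := by
    rw [← Finset.card_filter_add_card_filter_not fun q : Fin π.length => (q : ℕ) ≠ 0]
    refine Nat.add_le_add_left (Finset.card_le_one.2 fun a ha b hb => ?_) _
    simp only [Finset.mem_filter, not_not] at ha hb
    exact Fin.ext (ha.2.trans hb.2.symm)
  have hpL : ∀ q ∈ L, (p q : ℕ) + 1 = q := fun q hq => by
    have := (Finset.mem_filter.1 hq).2
    simp only [p]; omega
  have hwL : ∀ q, ∃ w, q ∈ L → Separates π w (p q) q := fun q => by
    by_cases hq : q ∈ L
    · obtain ⟨w, hw⟩ := mem_runStarts.1 (Finset.mem_filter.1 hq).1 (p q) (hpL q hq)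
      exact ⟨w, fun _ => hw⟩
    · exact ⟨q, fun h => absurd h hq⟩
  choose w hw using hwL
  -- pairs whose second positions have the same parity are disjoint
  obtain ⟨Q, hQL, hQc, hQp⟩ : ∃ Q ⊆ L, 2 * m * (6 * m + 1) ≤ Q.card ∧
      ∀ q ∈ Q, ∀ q' ∈ Q, q < q' → q < p q' := by
    have hpar : ∀ Q ⊆ L, ((∀ q ∈ Q, (q : ℕ) % 2 = 0) ∨ ∀ q ∈ Q, (q : ℕ) % 2 ≠ 0) →
        ∀ q ∈ Q, ∀ q' ∈ Q, q < q' → q < p q' := by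
      intro Q hQ h q hq q' hq' hlt
      have h1 := hpL q' (hQ hq')
      rw [Fin.lt_def] at hlt ⊢
      rcases h with h | h
      · have := h q hq; have := h q' hq'; omega
      · have := h q hq; have := h q' hq'; omega
    have hsplit := Finset.card_filter_add_card_filter_not (s := L)
      fun q : Fin π.length => (q : ℕ) % 2 = 0
    have hbig : 2 * (2 * m * (6 * m + 1)) ≤ L.card := by
      have : 2 * (2 * m * (6 * m + 1)) = 4 * m * (6 * m + 1) := by ring
      omega
    rcases le_total (2 * m * (6 * m + 1)) (L.filter fun q : Fin π.length => (q : ℕ) % 2 = 0).card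
      with h | h
    · exact ⟨_, Finset.filter_subset _ _, h, hpar _ (Finset.filter_subset _ _)
        (Or.inl fun q hq => (Finset.mem_filter.1 hq).2)⟩
    · exact ⟨_, Finset.filter_subset (fun q : Fin π.length => ¬ (q : ℕ) % 2 = 0) _, by omega,
        hpar _ (Finset.filter_subset _ _) (Or.inr fun q hq => (Finset.mem_filter.1 hq).2)⟩
  have hdeg : ∀ v, (Q.filter fun j => Separates π v (p j) j).card ≤ m := fun v => by
    by_contra hv
    obtain ⟨Q', hQ', hc⟩ := Finset.exists_subset_card_eq (not_le.1 hv).le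
    have hsub := hQ'.trans (Finset.filter_subset _ _)
    have := two_pow_le_of_common_separator hC hπ Q' p (fun q hq => hpL q (hQL (hsub hq)))
      (fun q hq q' hq' => hQp q (hsub hq) q' (hsub hq')) v
      fun q hq => (Finset.mem_filter.1 (hQ' hq)).2
    rw [hc] at this
    exact absurd this (not_le.2 (hmono _ (by omega)))
  obtain ⟨J, hJQ, hJc, hind⟩ := exists_independent_of_outdegree_le
    (fun k j => Separates π (p k) (p j) j ∨ Separates π k (p j) j ∨ Separates π (w k) (p j) j)
    (3 * m) Q fun k _ => by
      rw [Finset.filter_or, Finset.filter_or]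
      have h1 := Finset.card_union_le (Q.filter fun j => Separates π (p k) (p j) j)
        ((Q.filter fun j => Separates π k (p j) j) ∪ Q.filter fun j => Separates π (w k) (p j) j)
      have h2 := Finset.card_union_le (Q.filter fun j => Separates π k (p j) j)
        (Q.filter fun j => Separates π (w k) (p j) j)
      have h3 := hdeg (p k)
      have h4 := hdeg k
      have h5 := hdeg (w k)
      omega
  have hJm : 2 * m ≤ J.card := by
    have h1 := hQc.trans hJc
    have h2 : 2 * (3 * m) + 1 = 6 * m + 1 := by ring
    rw [h2, mul_comm (6 * m + 1)] at h1
    exact Nat.le_of_mul_le_mul_right h1 (by omega)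
  have hfin : ∀ K ⊆ J, ((∀ q ∈ K, q < w q) ∨ ∀ q ∈ K, w q < p q) → ¬ m ≤ K.card := by
    intro K hK hside hc
    obtain ⟨K', hK', hc⟩ := Finset.exists_subset_card_eq hc
    have hsub := hK'.trans hK
    have := two_pow_le_of_private_separators hC hπ K' p w
      (fun q hq => hpL q (hQL (hJQ (hsub hq)))) (fun q hq => hw q (hQL (hJQ (hsub hq))))
      (fun k hk j hj => hind k (hsub hk) j (hsub hj))
      (hside.imp (fun h q hq => h q (hK' hq)) fun h q hq => h q (hK' hq))
    rw [hc] at this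
    exact absurd this (not_le.2 (hmono _ (by omega)))
  have hsplit := Finset.card_filter_add_card_filter_not (s := J) fun q => q < w q
  have h1 := hfin (J.filter fun q => q < w q) (Finset.filter_subset _ _)
    (Or.inl fun q hq => (Finset.mem_filter.1 hq).2)
  have h2 := hfin (J.filter fun q => ¬ q < w q) (Finset.filter_subset _ _)
    (Or.inr fun q hq => by
      have hq' := Finset.mem_filter.1 hq
      have hqL := hQL (hJQ hq'.1)
      have h1 := Fin.val_ne_of_ne (hw q hqL).ne_left
      have h2 := Fin.val_ne_of_ne (hw q hqL).ne_right
      have h3 := hpL q hqL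
      have h4 := hq'.2
      rw [Fin.lt_def] at h4 ⊢
      omega)
  omega

/-- A polynomial grows at most like a power on the natural numbers. -/
theorem exists_abs_eval_le (q : Polynomial ℚ) :
    ∃ A d : ℕ, ∀ n : ℕ, |q.eval (n : ℚ)| ≤ A * ((n : ℚ) + 1) ^ d := by
  induction q using Polynomial.induction_on' with
  | add p q hp hq =>
    obtain ⟨A, d, hA⟩ := hp
    obtain ⟨B, e, hB⟩ := hq
    refine ⟨A + B, d + e, fun n => ?_⟩
    have h1 : (1 : ℚ) ≤ n + 1 := by simp
    rw [Polynomial.eval_add]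
    calc |p.eval (n : ℚ) + q.eval (n : ℚ)| ≤ _ := abs_add_le _ _
      _ ≤ A * ((n : ℚ) + 1) ^ d + B * ((n : ℚ) + 1) ^ e := add_le_add (hA n) (hB n)
      _ ≤ A * ((n : ℚ) + 1) ^ (d + e) + B * ((n : ℚ) + 1) ^ (d + e) := by
        gcongr <;> first | exact h1 | omega
      _ = _ := by push_cast; ring
  | monomial k a =>
    refine ⟨⌈|a|⌉₊, k, fun n => ?_⟩
    rw [Polynomial.eval_monomial, abs_mul, abs_pow, Nat.abs_cast]
    gcongr
    · exact Nat.le_ceil _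
    · simp

theorem ncard_length_le_le_sum (C : Set Permutation) (N : ℕ) :
    {π ∈ C | π.length ≤ N}.ncard ≤ ∑ n ∈ Finset.range (N + 1), countOfLength C n := by
  classical
  have hsub : {π ∈ C | π.length ≤ N} ⊆ ⋃ n ∈ Finset.range (N + 1),
      (fun σ : Equiv.Perm (Fin n) => (⟨n, σ⟩ : Permutation)) ''
        {σ : Equiv.Perm (Fin n) | (⟨n, σ⟩ : Permutation) ∈ C} := by
    rintro ⟨n, σ⟩ ⟨h1, h2⟩
    simp only [Set.mem_iUnion]
    exact ⟨n, Finset.mem_range.2 (Nat.lt_succ_of_le h2), σ, h1, rfl⟩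
  refine (Set.ncard_le_ncard hsub
    (Set.Finite.biUnion (Finset.finite_toSet _) fun n _ => Set.toFinite _)).trans ?_
  refine (Finset.set_ncard_biUnion_le _ _).trans (Finset.sum_le_sum fun n _ => ?_)
  exact Set.ncard_image_le (Set.toFinite _)

/-- A class with polynomial enumeration is small compared with `2 ^ m`. -/
theorem exists_ncard_lt_two_pow {C : Set Permutation} (hC : IsPolynomialClass C) :
    ∃ m, {π ∈ C | π.length ≤ 3 * m + 1}.ncard < 2 ^ m := by
  obtain ⟨-, q, N, hq⟩ := hC
  obtain ⟨A, d, hA⟩ := exists_abs_eval_le q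
  set B := ∑ n ∈ Finset.range N, countOfLength C n with hB
  have hcount : ∀ n, countOfLength C n ≤ (A + B) * (n + 1) ^ d := fun n => by
    rcases lt_or_ge n N with h | h
    · calc countOfLength C n ≤ B := Finset.single_le_sum (f := countOfLength C)
            (fun _ _ => Nat.zero_le _) (Finset.mem_range.2 h)
        _ ≤ A + B := Nat.le_add_left _ _
        _ ≤ _ := Nat.le_mul_of_pos_right _ (by positivity)
    · have h1 : (countOfLength C n : ℚ) ≤ A * ((n : ℚ) + 1) ^ d := by
        rw [hq n h]; exact (le_abs_self _).trans (hA n)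
      have h2 : countOfLength C n ≤ A * (n + 1) ^ d := by exact_mod_cast h1
      exact h2.trans (Nat.mul_le_mul_right _ (Nat.le_add_right _ _))
  have hlim := (tendsto_pow_const_div_const_pow_of_one_lt (d + 1)
    (one_lt_two : (1 : ℝ) < 2)).const_mul (((A + B : ℕ) : ℝ) * 5 ^ (d + 1))
  rw [mul_zero] at hlim
  obtain ⟨m, hm1, hm⟩ := ((hlim.eventually (gt_mem_nhds one_pos)).and
    (Filter.eventually_ge_atTop 1)).exists
  refine ⟨m, ?_⟩
  have h2m : (0 : ℝ) < 2 ^ m := by positivity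
  rw [← mul_div_assoc, div_lt_one h2m] at hm1
  have hm2 : (A + B) * 5 ^ (d + 1) * m ^ (d + 1) < 2 ^ m := by exact_mod_cast hm1
  refine lt_of_le_of_lt ?_ hm2
  calc {π ∈ C | π.length ≤ 3 * m + 1}.ncard
      ≤ ∑ n ∈ Finset.range (3 * m + 1 + 1), countOfLength C n := ncard_length_le_le_sum C _
    _ ≤ ∑ n ∈ Finset.range (3 * m + 1 + 1), (A + B) * (5 * m) ^ d := by
        refine Finset.sum_le_sum fun n hn => (hcount n).trans ?_
        rw [Finset.mem_range] at hn
        gcongr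
        omega
    _ = (3 * m + 2) * ((A + B) * (5 * m) ^ d) := by simp
    _ ≤ (5 * m) * ((A + B) * (5 * m) ^ d) := by gcongr; omega
    _ = _ := by rw [mul_pow]; ring

/-! ### Changing the block sizes -/

theorem IsPegMap.restrict {σ : PegPermutation} {π : Permutation} {f} (h : IsPegMap σ π f)
    (S : Finset (Fin π.length)) (hS : ∀ i, σ.peg i = .dot → ∃ p ∈ S, f p = i) :
    IsPegMap σ (π.restrict S) fun p => f (S.orderIsoOfFin rfl p) := by
  have hlt : ∀ p q : Fin S.card, p < q →
      (S.orderIsoOfFin rfl p : Fin π.length) < S.orderIsoOfFin rfl q :=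
    fun p q hpq => (S.orderIsoOfFin rfl).strictMono hpq
  refine ⟨fun p q hpq => h.mono ((S.orderIsoOfFin rfl).monotone hpq), fun p q hne => ?_,
    fun p q hpq he hp => ?_, fun p q hpq he hp => ?_, fun i hi => ?_⟩
  · exact (π.restrict_val_lt_iff S p q).trans (h.lt_iff _ _ hne)
  · exact (π.restrict_val_lt_iff S p q).2 (h.plus _ _ (hlt p q hpq) he hp)
  · exact (π.restrict_val_lt_iff S q p).2 (h.minus _ _ (hlt p q hpq) he hp)
  · obtain ⟨p, hpS, hp⟩ := hS i hi
    refine ⟨(S.orderIsoOfFin rfl).symm ⟨p, hpS⟩, by simpa using hp, fun q hq => ?_⟩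
    have := (h.dot i hi).unique hp hq
    exact (OrderIso.eq_symm_apply _).2 (Subtype.ext this.symm)

theorem blockSize_restrict {n k : ℕ} (f : Fin n → Fin k) (S : Finset (Fin n)) (i : Fin k) :
    blockSize (fun p => f (S.orderIsoOfFin rfl p)) i = (S.filter fun p => f p = i).card := by
  refine Finset.card_bij (fun p _ => (S.orderIsoOfFin rfl p : Fin n)) ?_ ?_ ?_
  · intro p hp
    rw [Finset.mem_filter] at hp ⊢
    exact ⟨(S.orderIsoOfFin rfl p).2, hp.2⟩
  · intro p _ q _ hpq
    exact (S.orderIsoOfFin rfl).injective (Subtype.ext hpq)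
  · intro p hp
    rw [Finset.mem_filter] at hp
    refine ⟨(S.orderIsoOfFin rfl).symm ⟨p, hp.1⟩, Finset.mem_filter.2 ⟨Finset.mem_univ _, ?_⟩, ?_⟩
    · change f (S.orderIsoOfFin rfl ((S.orderIsoOfFin rfl).symm ⟨p, hp.1⟩)) = i
      rw [OrderIso.apply_symm_apply]
      exact hp.2
    · rw [OrderIso.apply_symm_apply]

/-- The block sizes of a member of a class can be decreased within the class. -/
theorem exists_mem_blockSize_eq_of_le {C : Set Permutation} (hC : IsPermClass C)
    {σ : PegPermutation} {π : Permutation} (hπ : π ∈ C) {f} (h : IsPegMap σ π f)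
    (a : Fin σ.perm.length → ℕ) (ha : ∀ i, a i ≤ blockSize f i)
    (hdot : ∀ i, σ.peg i = .dot → a i = 1) :
    ∃ π' ∈ C, ∃ f', IsPegMap σ π' f' ∧ ∀ i, blockSize f' i = a i := by
  classical
  choose T hT hTc using fun i => Finset.exists_subset_card_eq (ha i)
  have hTf : ∀ i, ∀ p ∈ T i, f p = i := fun i p hp => (Finset.mem_filter.1 (hT i hp)).2
  let S := Finset.univ.biUnion T
  have hS : ∀ i, (S.filter fun p => f p = i) = T i := fun i => by
    ext p
    simp only [S, Finset.mem_filter, Finset.mem_biUnion, Finset.mem_univ, true_and]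
    constructor
    · rintro ⟨⟨j, hj⟩, rfl⟩
      rw [hTf j p hj]
      exact hj
    · exact fun hp => ⟨⟨i, hp⟩, hTf i p hp⟩
  refine ⟨π.restrict S, mem_of_contains hC hπ (contains_restrict _ _), _,
    h.restrict S fun i hi => ?_, fun i => ?_⟩
  · obtain ⟨p, hp⟩ := Finset.card_pos.1 (by rw [hTc, hdot i hi]; exact one_pos : 0 < (T i).card)
    exact ⟨p, Finset.mem_biUnion.2 ⟨i, Finset.mem_univ _, hp⟩, hTf i p hp⟩
  · exact (blockSize_restrict f S i).trans (by rw [hS, hTc])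

/-- By Dickson's lemma, whether a vector lies below a member of `D` depends only on its entries
cut off at some threshold. -/
theorem exists_threshold {k : ℕ} (D : Set (Fin k → ℕ)) :
    ∃ N, ∀ N' ≥ N, ∀ a : Fin k → ℕ, (∃ b ∈ D, ∀ i, min (a i) N' ≤ b i) → ∃ b ∈ D, ∀ i, a i ≤ b i := by
  suffices h : ∃ N, ∀ a : Fin k → ℕ, (∃ b ∈ D, ∀ i, min (a i) N ≤ b i) →
      ∃ b ∈ D, ∀ i, a i ≤ b i by
    obtain ⟨N, hN⟩ := h
    exact ⟨N, fun N' hN' a ⟨b, hb, hab⟩ => hN a ⟨b, hb, fun i =>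
      (min_le_min_left _ hN').trans (hab i)⟩⟩
  by_contra hn
  push Not at hn
  choose a ha hna using hn
  obtain ⟨g, hg⟩ := (wellQuasiOrdered_iff_exists_monotone_subseq.1
    (wellQuasiOrdered_le (α := Fin k → ℕ))) a
  set j := ∑ i, a (g 0) i
  obtain ⟨b, hb, hle⟩ := ha (g j)
  obtain ⟨i, hi⟩ := hna (g 0) b hb
  have h1 : a (g 0) i ≤ a (g j) i := hg 0 j (Nat.zero_le _) i
  have h2 : a (g 0) i ≤ j := Finset.single_le_sum (f := a (g 0)) (fun _ _ => Nat.zero_le _)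
    (Finset.mem_univ i)
  have h3 : j ≤ g j := g.strictMono.le_apply
  have := hle i
  omega

instance : Finite Peg :=
  Finite.of_injective (fun p : Peg => match p with
    | .plus => (0 : Fin 3)
    | .minus => 1
    | .dot => 2) fun a b => by cases a <;> cases b <;> simp

theorem finite_pegPermutation (R : ℕ) : {σ : PegPermutation | σ.perm.length ≤ R}.Finite := by
  have : (⋃ n ∈ Finset.range (R + 1),
      Set.range fun x : Equiv.Perm (Fin n) × (Fin n → Peg) =>
        (⟨⟨n, x.1⟩, x.2⟩ : PegPermutation)).Finite :=
    Set.Finite.biUnion (Finset.finite_toSet _) fun n _ => Set.finite_range _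
  refine this.subset fun σ hσ => ?_
  simp only [Set.mem_iUnion]
  exact ⟨σ.perm.1, Finset.mem_range.2 (Nat.lt_succ_of_le hσ), ⟨σ.perm.2, σ.peg⟩, rfl⟩

/-- For peg permutations of length at most `R`, a vector `a` of block sizes occurs in `C` as soon as
the entries of `a`, cut off at `N`, are bounded by the block sizes of some member of `C`. -/
def IsThreshold (C : Set Permutation) (R N : ℕ) : Prop :=
  ∀ σ : PegPermutation, σ.perm.length ≤ R → ∀ a : Fin σ.perm.length → ℕ,
    (∃ π ∈ C, ∃ f, IsPegMap σ π f ∧ ∀ i, min (a i) N ≤ blockSize f i) →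
    (∀ i, σ.peg i = .dot → a i = 1) →
    ∃ π ∈ C, ∃ f, IsPegMap σ π f ∧ ∀ i, blockSize f i = a i

theorem exists_isThreshold {C : Set Permutation} (hC : IsPermClass C) (R : ℕ) :
    ∃ N ≥ 2, IsThreshold C R N := by
  choose N hN using fun σ : PegPermutation => exists_threshold
    {b | ∃ π ∈ C, ∃ f, IsPegMap σ π f ∧ b = blockSize f}
  obtain ⟨M, hM⟩ := ((finite_pegPermutation R).image N).bddAbove
  refine ⟨max M 2, le_max_right _ _, fun σ hσ a ⟨π, hπ, f, hf, hle⟩ hdot => ?_⟩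
  obtain ⟨_, ⟨π', hπ', f', hf', rfl⟩, hle'⟩ := hN σ (max M 2)
    ((hM ⟨σ, hσ, rfl⟩).trans (le_max_left _ _)) a ⟨_, ⟨π, hπ, f, hf, rfl⟩, hle⟩
  exact exists_mem_blockSize_eq_of_le hC hπ' hf' a hle' hdot

/-- Sizes of at least `N` are all represented by `N + 1`: a run of such a size is covered by `N` dots
and one signed letter, whose cell may be empty. -/
def truncate (N l : ℕ) : ℕ := if l < N then l else N + 1

/-- Membership in the class depends only on the run shape and the truncated lengths of the runs. -/
theorem IsThreshold.mem_of_truncate_eq {C : Set Permutation} {R N : ℕ}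
    (hN : IsThreshold C R N) {σ : PegPermutation} (hσ : σ.perm.length ≤ R) {π π' : Permutation}
    {f f'} (h : IsPegMap σ π f) (h' : IsPegMap σ π' f') (hπ : π ∈ C)
    (ht : ∀ i, truncate N (blockSize f' i) = blockSize f i) : π' ∈ C := by
  obtain ⟨π'', hπ'', f'', h'', hs⟩ := hN σ hσ (blockSize f') ⟨π, hπ, f, h, fun i => by
    have := ht i
    rw [truncate] at this
    split_ifs at this <;> omega⟩ fun i hi => h'.blockSize_eq_one hi
  exact h''.eq_of_blockSize_eq h' hs ▸ hπ''

theorem IsThreshold.exists_truncate {C : Set Permutation} {R N : ℕ}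
    (hN : IsThreshold C R N) (hN2 : 2 ≤ N) {σ : PegPermutation} (hσ : σ.perm.length ≤ R)
    {π : Permutation} (hπ : π ∈ C) {f} (h : IsRunShape σ π f) :
    ∃ τ ∈ C, ∃ g, IsRunShape σ τ g ∧ ∀ i, truncate N (blockSize f i) = blockSize g i := by
  obtain ⟨τ, hτ, g, hg, hs⟩ := hN σ hσ (fun i => truncate N (blockSize f i))
    ⟨π, hπ, f, h.toIsPegMap, fun i => by rw [truncate]; split_ifs <;> omega⟩
    fun i hi => by rw [h.blockSize_eq_one hi, truncate, if_pos (by omega)]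
  refine ⟨τ, hτ, g, ⟨hg, fun i hi => ?_, h.compact⟩, fun i => (hs i).symm⟩
  have := h.two_le i hi
  rw [hs, truncate]
  split_ifs <;> omega

/-! ### The peg permutation of a truncated permutation -/

open Classical in
/-- The peg permutation with underlying permutation `τ` in which the last letter of each run of
length `N + 1` is decorated with the direction of the run, and every other letter with a dot. -/
noncomputable def rulePeg (N : ℕ) (σ : PegPermutation) (τ : Permutation)
    (f : Fin τ.length → Fin σ.perm.length) : PegPermutation where
  perm := τ
  peg x := if blockSize f (f x) = N + 1 ∧ ∀ y, f y = f x → y ≤ x then σ.peg (f x) else .dot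

section rulePeg

variable {N : ℕ} {σ : PegPermutation} {τ : Permutation} {f : Fin τ.length → Fin σ.perm.length}

theorem rulePeg_peg_of_ne_dot {x : Fin τ.length} (h : (rulePeg N σ τ f).peg x ≠ .dot) :
    blockSize f (f x) = N + 1 ∧ (∀ y, f y = f x → y ≤ x) ∧
      (rulePeg N σ τ f).peg x = σ.peg (f x) := by
  simp only [rulePeg] at h ⊢
  split_ifs at h ⊢ with h1
  · exact ⟨h1.1, h1.2, rfl⟩
  · exact absurd rfl h

theorem exists_last_of_block {n k : ℕ} {f : Fin n → Fin k} (hf : Function.Surjective f)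
    (i : Fin k) : ∃ x, f x = i ∧ ∀ y, f y = i → y ≤ x := by
  obtain ⟨x, hx⟩ := hf i
  obtain ⟨m, hm, hmax⟩ := Finset.exists_max_image (Finset.univ.filter fun y => f y = i) id
    ⟨x, by simpa using hx⟩
  exact ⟨m, by simpa using hm, fun y hy => hmax y (by simpa using hy)⟩

theorem blockSize_comp {l n k : ℕ} (f : Fin n → Fin k) (h : Fin l → Fin n) (i : Fin k) :
    blockSize (f ∘ h) i = ∑ x ∈ Finset.univ.filter fun x => f x = i, blockSize h x := by
  rw [blockSize, Finset.card_eq_sum_card_fiberwise (f := h)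
    (t := Finset.univ.filter fun x => f x = i) (fun p hp => by simpa using hp)]
  refine Finset.sum_congr rfl fun x hx => ?_
  rw [blockSize, Finset.filter_filter]
  congr 1
  refine Finset.filter_congr fun p _ => ?_
  simp only [Finset.mem_filter, Finset.mem_univ, true_and] at hx
  exact ⟨fun e => e.2, fun e => ⟨by simp [e, hx], e⟩⟩

variable {π : Permutation} {h h' : Fin π.length → Fin τ.length}

/-- In each block, all letters but the last carry a dot and account for one point each. -/
theorem blockSize_comp_add_one (hh : IsPegMap (rulePeg N σ τ f) π h) {x : Fin τ.length}
    (hx : ∀ y, f y = f x → y ≤ x) :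
    blockSize (f ∘ h) (f x) + 1 = blockSize f (f x) + blockSize h x := by
  have hmem : x ∈ Finset.univ.filter fun y => f y = f x := by simp
  have hone : ∀ y ∈ (Finset.univ.filter fun y => f y = f x).erase x, blockSize h y = 1 := by
    intro y hy
    simp only [Finset.mem_erase, Finset.mem_filter, Finset.mem_univ, true_and] at hy
    refine hh.blockSize_eq_one ?_
    by_contra hd
    exact hy.1 (le_antisymm (hx y hy.2) ((rulePeg_peg_of_ne_dot hd).2.1 x hy.2.symm))
  rw [blockSize_comp, ← Finset.add_sum_erase _ _ hmem, Finset.sum_congr rfl hone,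
    Finset.sum_const, smul_eq_mul, mul_one, Finset.card_erase_of_mem hmem]
  have : 0 < (Finset.univ.filter fun y => f y = f x).card := Finset.card_pos.2 ⟨x, hmem⟩
  change blockSize h x + (blockSize f (f x) - 1) + 1 = _
  change 0 < blockSize f (f x) at this
  omega

/-- Every permutation in the grid class of the peg permutation of `τ` has the same run shape as `τ`,
and the truncated lengths of its runs are the lengths of the runs of `τ`. -/
theorem IsRunShape.comp (hN : 2 ≤ N) (hf : IsRunShape σ τ f)
    (hs : ∀ i, blockSize f i < N ∨ blockSize f i = N + 1)
    (hh : IsPegMap (rulePeg N σ τ f) π h) :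
    IsRunShape σ π (f ∘ h) ∧ ∀ i, truncate N (blockSize (f ∘ h) i) = blockSize f i := by
  have hlt : ∀ p q, p < q → h p ≠ h q → h p < h q := fun p q hpq hne =>
    lt_of_le_of_ne (hh.mono hpq.le) hne
  have hM : IsPegMap σ π (f ∘ h) := by
    refine ⟨hf.mono.comp hh.mono, fun p q hne => ?_, fun p q hpq he hp => ?_,
      fun p q hpq he hp => ?_, fun i hi => ?_⟩
    · exact (hh.lt_iff p q fun e => hne (congrArg f e)).trans (hf.lt_iff _ _ hne)
    · by_cases hpq' : h p = h q
      · have hd : (rulePeg N σ τ f).peg (h p) ≠ .dot := fun hd =>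
          hpq.ne ((hh.dot _ hd).unique rfl hpq'.symm)
        exact hh.plus p q hpq hpq' ((rulePeg_peg_of_ne_dot hd).2.2.trans hp)
      · exact (hh.lt_iff p q hpq').2 (hf.plus _ _ (hlt p q hpq hpq') he hp)
    · by_cases hpq' : h p = h q
      · have hd : (rulePeg N σ τ f).peg (h p) ≠ .dot := fun hd =>
          hpq.ne ((hh.dot _ hd).unique rfl hpq'.symm)
        exact hh.minus p q hpq hpq' ((rulePeg_peg_of_ne_dot hd).2.2.trans hp)
      · exact (hh.lt_iff q p (Ne.symm hpq')).2 (hf.minus _ _ (hlt p q hpq hpq') he hp)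
    · obtain ⟨x, rfl, hx⟩ := hf.dot i hi
      have hd : (rulePeg N σ τ f).peg x = .dot := by
        by_contra hd
        have := (rulePeg_peg_of_ne_dot hd).1
        have := hf.blockSize_eq_one hi
        omega
      obtain ⟨p, hp, hu⟩ := hh.dot x hd
      exact ⟨p, congrArg f hp, fun q hq => hu q (hx _ hq)⟩
  have ht : ∀ i, truncate N (blockSize (f ∘ h) i) = blockSize f i := fun i => by
    obtain ⟨x, rfl, hx⟩ := exists_last_of_block hf.surjective i
    have h1 := blockSize_comp_add_one hh hx
    rcases hs (f x) with h2 | h2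
    · have hd : (rulePeg N σ τ f).peg x = .dot := by
        by_contra hd
        have := (rulePeg_peg_of_ne_dot hd).1
        omega
      have h3 : blockSize h x = 1 := hh.blockSize_eq_one hd
      rw [truncate, if_pos (by omega)]
      omega
    · rw [truncate, if_neg (by omega), h2]
  refine ⟨⟨hM, fun i hi => ?_, hf.compact⟩, ht⟩
  have h1 := ht i
  have h2 := hf.two_le i hi
  rw [truncate] at h1
  split_ifs at h1 <;> omega

theorem pegMap_rulePeg_unique (hN : 2 ≤ N) (hf : IsRunShape σ τ f)
    (hs : ∀ i, blockSize f i < N ∨ blockSize f i = N + 1)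
    (hh : IsPegMap (rulePeg N σ τ f) π h) (hh' : IsPegMap (rulePeg N σ τ f) π h') : h = h' := by
  have he : f ∘ h = f ∘ h' := (hf.comp hN hs hh).1.map_eq (hf.comp hN hs hh').1
  refine eq_of_blockSize_eq hh.mono hh'.mono fun x => ?_
  by_cases hd : (rulePeg N σ τ f).peg x = .dot
  · exact (hh.blockSize_eq_one hd).trans (hh'.blockSize_eq_one hd).symm
  · have hx := (rulePeg_peg_of_ne_dot hd).2.1
    have h1 := blockSize_comp_add_one hh hx
    have h2 := blockSize_comp_add_one hh' hx
    rw [he] at h1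
    change blockSize h x = blockSize h' x
    omega

theorem eq_of_pegMap_rulePeg (hN : 2 ≤ N) (hf : IsRunShape σ τ f)
    (hs : ∀ i, blockSize f i < N ∨ blockSize f i = N + 1)
    (hh : IsPegMap (rulePeg N σ τ f) π h) {σ' : PegPermutation} {τ' : Permutation} {f'}
    (hf' : IsRunShape σ' τ' f') (hs' : ∀ i, blockSize f' i < N ∨ blockSize f' i = N + 1)
    {h' : Fin π.length → Fin τ'.length} (hh' : IsPegMap (rulePeg N σ' τ' f') π h') : τ = τ' := by
  have h1 := hf.comp hN hs hh
  have h2 := hf'.comp hN hs' hh'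
  obtain rfl := h1.1.shape_eq h2.1
  have he := h1.1.map_eq h2.1
  refine hf.eq_of_blockSize_eq hf'.toIsPegMap fun i => ?_
  rw [← h1.2, ← h2.2, he]

/-- Block `i` of a monotone map is an interval that starts after the points of smaller blocks. -/
theorem eq_iff_mem_block {n k : ℕ} {f : Fin n → Fin k} (hf : Monotone f) (x : Fin n) (i : Fin k) :
    f x = i ↔ (Finset.univ.filter fun y => f y < i).card ≤ x ∧
      (x : ℕ) < (Finset.univ.filter fun y => f y < i).card + blockSize f i := by
  have h1 := lt_card_filter_iff (fun y => f y < i) (fun a b hab hb => (hf hab).trans_lt hb) x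
  have h2 := lt_card_filter_iff (fun y => f y ≤ i) (fun a b hab hb => (hf hab).trans hb) x
  have h3 : (Finset.univ.filter fun y => f y ≤ i).card =
      (Finset.univ.filter fun y => f y < i).card + blockSize f i := by
    rw [blockSize, ← Finset.card_union_of_disjoint, ← Finset.filter_or]
    · simp only [le_iff_lt_or_eq]
    · exact Finset.disjoint_filter.2 fun y _ h => h.ne
  rw [← h3, h2, ← not_lt, h1, not_lt]
  exact ⟨fun e => ⟨e.ge, e.le⟩, fun e => le_antisymm e.2 e.1⟩

/-- A permutation of the same run shape as `τ` whose truncated run lengths are the run lengths of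
`τ` lies in the grid class of the peg permutation of `τ`. -/
theorem exists_pegMap_rulePeg (hN : 1 ≤ N) (hf : IsRunShape σ τ f) {g}
    (hg : IsRunShape σ π g) (ht : ∀ i, truncate N (blockSize g i) = blockSize f i) :
    ∃ h, IsPegMap (rulePeg N σ τ f) π h := by
  let s : Fin σ.perm.length → ℕ := fun i => (Finset.univ.filter fun y => f y < i).card
  let t : Fin σ.perm.length → ℕ := fun i => (Finset.univ.filter fun y => g y < i).card
  have hsf : ∀ x i, f x = i ↔ s i ≤ (x : ℕ) ∧ (x : ℕ) < s i + blockSize f i :=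
    eq_iff_mem_block hf.mono
  have htg : ∀ p i, g p = i ↔ t i ≤ (p : ℕ) ∧ (p : ℕ) < t i + blockSize g i :=
    eq_iff_mem_block hg.mono
  have hpos : ∀ i, 0 < blockSize f i := fun i => by
    obtain ⟨x, hx⟩ := hf.surjective i
    exact Finset.card_pos.2 ⟨x, by simpa using hx⟩
  -- the points of a run of `π` are matched in order with those of the run of `τ`; when the latter is
  -- exhausted, the remaining points go to its last letter
  have hex : ∀ p, ∃ x : Fin τ.length,
      (x : ℕ) = s (g p) + min (p - t (g p)) (blockSize f (g p) - 1) := fun p => by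
    have h2 := hpos (g p)
    have h3 : s (g p) + blockSize f (g p) ≤ τ.length := by
      have h4 : (Finset.univ.filter fun y => f y < g p).card +
          (Finset.univ.filter fun y => f y = g p).card ≤ τ.length := by
        rw [← Finset.card_union_of_disjoint
          (Finset.disjoint_filter.2 fun y _ h => h.ne)]
        exact (Finset.card_le_univ _).trans (by simp)
      exact h4
    exact ⟨⟨_, by omega⟩, rfl⟩
  choose h hh using hex
  have hfh : ∀ p, f (h p) = g p := fun p => by
    rw [hsf, hh]
    have := hpos (g p)
    omega
  have hmono : Monotone h := fun p q hpq => by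
    rcases (hg.mono hpq).lt_or_eq with hlt | he
    · by_contra hn
      have := hf.mono (not_le.1 hn).le
      rw [hfh, hfh] at this
      exact not_lt.2 this hlt
    · rw [Fin.le_def, hh, hh, he]
      rw [Fin.le_def] at hpq
      omega
  have key : ∀ p q, p < q → h p ≠ h q →
      (π.val p < π.val q ↔ τ.val (h p) < τ.val (h q)) := fun p q hpq hne => by
    by_cases he : g p = g q
    · have hlt := lt_of_le_of_ne (hmono hpq.le) hne
      have he' : f (h p) = f (h q) := by rw [hfh, hfh, he]
      cases hpeg : σ.peg (g p) with
      | plus =>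
        exact iff_of_true (hg.plus p q hpq he hpeg)
          (hf.plus _ _ hlt he' (by rw [hfh, hpeg]))
      | minus =>
        exact iff_of_false (lt_asymm (hg.minus p q hpq he hpeg))
          (lt_asymm (hf.minus _ _ hlt he' (by rw [hfh, hpeg])))
      | dot => exact absurd ((hg.dot _ hpeg).unique rfl he.symm) hpq.ne
    · rw [hg.lt_iff p q he, hf.lt_iff (h p) (h q) (by rwa [hfh, hfh]), hfh, hfh]
  refine ⟨h, hmono, fun p q hne => ?_, fun p q hpq he hp => ?_, fun p q hpq he hp => ?_,
    fun x hx => ?_⟩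
  · change π.val p < π.val q ↔ τ.val (h p) < τ.val (h q)
    rcases lt_trichotomy p q with hpq | rfl | hpq
    · exact key p q hpq hne
    · exact absurd rfl hne
    · have := key q p hpq hne.symm
      rw [← not_iff_not, not_lt, not_lt, (π.2.injective.ne hpq.ne).le_iff_lt,
        (τ.2.injective.ne hne.symm).le_iff_lt]
      exact this
  · have := (rulePeg_peg_of_ne_dot (by rw [hp]; exact Peg.noConfusion)).2.2.symm.trans hp
    rw [hfh] at this
    exact hg.plus p q hpq (by rw [← hfh, ← hfh, he]) this
  · have := (rulePeg_peg_of_ne_dot (by rw [hp]; exact Peg.noConfusion)).2.2.symm.trans hp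
    rw [hfh] at this
    exact hg.minus p q hpq (by rw [← hfh, ← hfh, he]) this
  · change Fin τ.length at x
    have hxs := (hsf x _).1 rfl
    have htx := ht (f x)
    have hy : blockSize f (f x) ≠ N + 1 ∨ (x : ℕ) + 1 < s (f x) + blockSize f (f x) := by
      by_contra hn
      rw [not_or, not_not, not_lt] at hn
      have hlast : ∀ y, f y = f x → y ≤ x := fun y hy => by
        have := (hsf y _).1 hy
        rw [Fin.le_def]; omega
      have h1 : (rulePeg N σ τ f).peg x = σ.peg (f x) := if_pos ⟨hn.1, hlast⟩
      have := hf.blockSize_eq_one (h1.symm.trans hx)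
      omega
    have hsize : (x : ℕ) - s (f x) < blockSize g (f x) ∧ ∀ z < blockSize g (f x),
        min z (blockSize f (f x) - 1) = x - s (f x) → z = x - s (f x) := by
      rw [truncate] at htx
      split_ifs at htx with h1
      · exact ⟨by omega, fun z hz => by omega⟩
      · exact ⟨by omega, fun z hz => by omega⟩
    have hlt : t (f x) + (x - s (f x)) < π.length := by
      have h4 : (Finset.univ.filter fun y => g y < f x).card +
          (Finset.univ.filter fun y => g y = f x).card ≤ π.length := by
        rw [← Finset.card_union_of_disjoint
          (Finset.disjoint_filter.2 fun y _ h => h.ne)]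
        exact (Finset.card_le_univ _).trans (by simp)
      change t (f x) + blockSize g (f x) ≤ π.length at h4
      omega
    have hgp : g ⟨_, hlt⟩ = f x := (htg _ _).2 ⟨by simp, by simp; omega⟩
    refine ⟨⟨_, hlt⟩, ?_, fun q hq => ?_⟩
    · refine Fin.ext ?_
      rw [hh, hgp]
      simp only
      omega
    · have hgq : g q = f x := by rw [← hfh, hq]
      have h1 := (htg q _).1 hgq
      have h2 := hh q
      rw [hgq, hq] at h2
      have h3 := hsize.2 (q - t (f x)) (by omega) (by omega)
      refine Fin.ext ?_
      simp only
      omega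

end rulePeg

/-! ### The block set -/

theorem mem_Av_p21_iff (π : Permutation) :
    π ∈ Av {p21} ↔ ∀ p q, p < q → π.val p < π.val q := by
  have h := restrict_mem_Av_p21_iff π Finset.univ
  rw [(contains_restrict π Finset.univ).eq_of_length_eq (Finset.card_fin _)] at h
  simpa using h

theorem mem_Av_p12_iff (π : Permutation) :
    π ∈ Av {p12} ↔ ∀ p q, p < q → π.val q < π.val p := by
  have h := restrict_mem_Av_p12_iff π Finset.univ
  rw [(contains_restrict π Finset.univ).eq_of_length_eq (Finset.card_fin _)] at h
  simpa using h

theorem contains_of_mem_Av_p21 {π p : Permutation} (hπ : π ∈ Av {p21}) (hp : p ∈ Av {p21})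
    (h : p.length ≤ π.length) : π.Contains p := by
  rw [mem_Av_p21_iff] at hπ hp
  have hπ' : StrictMono π.val := fun a b => hπ a b
  have hp' : StrictMono p.val := fun a b => hp a b
  refine ⟨Fin.castLE h, Fin.strictMono_castLE h, fun i j => ?_⟩
  rw [hπ'.lt_iff_lt, hp'.lt_iff_lt, (Fin.strictMono_castLE h).lt_iff_lt]

theorem contains_of_mem_Av_p12 {π p : Permutation} (hπ : π ∈ Av {p12}) (hp : p ∈ Av {p12})
    (h : p.length ≤ π.length) : π.Contains p := by
  rw [mem_Av_p12_iff] at hπ hp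
  have hπ' : StrictAnti π.val := fun a b => hπ a b
  have hp' : StrictAnti p.val := fun a b => hp a b
  refine ⟨Fin.castLE h, Fin.strictMono_castLE h, fun i j => ?_⟩
  rw [hπ'.lt_iff_gt, hp'.lt_iff_gt, (Fin.strictMono_castLE h).lt_iff_lt]

theorem infinite_Av_p21 : (Av {p21}).Infinite :=
  Set.infinite_of_injective_forall_mem (f := fun n : ℕ => (⟨n, Equiv.refl _⟩ : Permutation))
    (fun _ _ h => congrArg Sigma.fst h) fun _ => (mem_Av_p21_iff _).2 fun _ _ hpq => hpq

theorem infinite_Av_p12 : (Av {p12}).Infinite :=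
  Set.infinite_of_injective_forall_mem (f := fun n : ℕ => (⟨n, Fin.revPerm⟩ : Permutation))
    (fun _ _ h => congrArg Sigma.fst h) fun _ => (mem_Av_p12_iff _).2 fun p q hpq => by
      change Fin.revPerm q < Fin.revPerm p
      simpa using hpq

theorem isPermClass_Av (P : Set Permutation) : IsPermClass (Av P) := by
  refine Set.Subset.antisymm ?_ fun π hπ => ⟨π, hπ, Contains.refl π⟩
  rintro p ⟨π, hπ, h⟩ q hq hpq
  exact hπ q hq (h.trans hpq)

/-- The minimal non-members of a class form its basis. -/
theorem exists_isBasis {C : Set Permutation} (hC : IsPermClass C) : ∃ B, IsBasis B C := by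
  refine ⟨{p | p ∉ C ∧ ∀ q, p.Contains q → q ≠ p → q ∈ C}, ?_, ?_⟩
  · refine Set.Subset.antisymm (fun π hπ p hp hc => hp.1 (mem_of_contains hC hπ hc)) ?_
    intro π hπ
    by_contra hn
    have key : ∀ n, ∀ q : Permutation, q.length = n → π.Contains q → q ∈ C := by
      intro n
      induction n using Nat.strong_induction_on with
      | _ n ih =>
        intro q hq hπq
        by_contra hqC
        refine hπ q ⟨hqC, fun r hr hne => ?_⟩ hπq
        have hlt : r.length < q.length :=
          lt_of_le_of_ne (contains_length_le hr) fun e => hne (hr.eq_of_length_eq e)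
        exact ih _ (hq ▸ hlt) r rfl (hπq.trans hr)
    exact hn (key _ π rfl (Contains.refl π))
  · rintro p ⟨hp, hmin⟩
    ext q
    constructor
    · rintro ⟨⟨_, rfl, hq⟩, hqC, -⟩
      by_contra hne
      exact hqC (hmin q hq hne)
    · rintro rfl
      exact ⟨⟨_, rfl, Contains.refl _⟩, hp, hmin⟩

theorem Av_singleton_mem_blockSet {C : Set Permutation} (hC : IsPermClass C) (hne : C ≠ Set.univ)
    {x : Permutation} (hx : Av {x} ⊆ C) (hinf : (Av {x}).Infinite) : Av {x} ∈ blockSet C := by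
  obtain ⟨B, hB⟩ := exists_isBasis hC
  have hxB : ∀ p ∈ B, p.Contains x := fun p hp => by
    by_contra hn
    have hpC : p ∈ C := hx (by rintro _ rfl; exact hn)
    rw [hB.1] at hpC
    exact hpC p hp (Contains.refl p)
  have hBne : B.Nonempty := by
    rw [Set.nonempty_iff_ne_empty]
    rintro rfl
    exact hne (hB.1.trans (Set.eq_univ_of_forall fun π p hp => absurd hp (Set.notMem_empty p)))
  obtain ⟨p, hp⟩ := hBne
  refine Or.inl (Or.inl ⟨B, {x}, hB, ?_, fun p hp => ?_, rfl, hinf⟩)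
  · rintro _ rfl
    exact ⟨p, hp, hxB p hp⟩
  · exact ⟨x, rfl, p, rfl, hxB p hp⟩

theorem ne_univ_of_ncard_lt {C : Set Permutation} {m : ℕ}
    (hm : {π ∈ C | π.length ≤ 3 * m + 1}.ncard < 2 ^ m) : C ≠ Set.univ := by
  rintro rfl
  refine absurd hm (not_lt.2 ?_)
  have h1 : ∀ m, 2 ^ m ≤ (m + 1).factorial := fun m => by
    induction m with
    | zero => simp
    | succ m ih =>
      rw [pow_succ, mul_comm, Nat.factorial_succ (m + 1)]
      exact Nat.mul_le_mul (by omega) ih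
  have h2 : ((fun σ : Equiv.Perm (Fin (m + 1)) => (⟨m + 1, σ⟩ : Permutation)) ''
      Set.univ).ncard = (m + 1).factorial := by
    rw [Set.InjOn.ncard_image, Set.ncard_univ, Nat.card_eq_fintype_card, Fintype.card_perm,
      Fintype.card_fin]
    exact fun a _ b _ h => eq_of_heq (Sigma.mk.inj h).2
  refine (h1 m).trans (h2 ▸ Set.ncard_le_ncard ?_ (finite_length_le _ _))
  rintro _ ⟨σ, -, rfl⟩
  exact ⟨Set.mem_univ _, show m + 1 ≤ 3 * m + 1 by omega⟩

/-! ### The cover -/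

theorem mem_grid_emptyRule_iff {π : Permutation} :
    π ∈ GridMatrix.emptyRule.Grid ↔ π.length = 0 := by
  constructor
  · rintro ⟨g, ⟨-, hc0, hcl⟩, ⟨-, hr0, hrl⟩, hb⟩
    have := hb (0 : Fin 1) (0 : Fin 1)
    change π.restrict _ ∈ Av {one} at this
    rw [restrict_mem_Av_one_iff] at this
    by_contra hn
    let p : Fin π.length := ⟨0, Nat.pos_of_ne_zero hn⟩
    refine Finset.notMem_empty p (this ▸ Finset.mem_filter.2 ⟨Finset.mem_univ _, ?_⟩)
    change g.1 0 = 0 at hc0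
    change g.2 0 = 0 at hr0
    change g.1 1 = π.length at hcl
    change g.2 1 = π.length at hrl
    change (g.1 0 ≤ _ ∧ _ < g.1 1) ∧ (g.2 0 ≤ _ ∧ _ < g.2 1)
    rw [hc0, hr0, hcl, hrl]
    exact ⟨⟨Nat.zero_le _, p.2⟩, Nat.zero_le _, (π.val p).2⟩
  · intro h
    refine ⟨(fun _ => 0, fun _ => 0), ⟨monotone_const, rfl, h.symm⟩, ⟨monotone_const, rfl, h.symm⟩,
      fun k l => ?_⟩
    change π.restrict _ ∈ Av {one}
    rw [restrict_mem_Av_one_iff]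
    exact Finset.eq_empty_of_forall_notMem fun p => absurd p.2 (by omega)

theorem isStructRule_emptyRule : GridMatrix.emptyRule.IsStructRule := by
  refine ⟨fun _ _ => Or.inl (isPermClass_Av _), fun π hπ => ?_⟩
  have h0 := mem_grid_emptyRule_iff.1 hπ
  obtain ⟨g, hg⟩ := hπ
  have hz : ∀ g, GridMatrix.emptyRule.IsGridding π g → g = (fun _ => 0, fun _ => 0) := by
    rintro ⟨c, r⟩ ⟨⟨hc, -, hcl⟩, ⟨hr, -, hrl⟩, -⟩
    refine Prod.ext (funext fun j => ?_) (funext fun j => ?_)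
    · exact Nat.le_zero.1 ((hc (Fin.le_last j)).trans (hcl.trans h0).le)
    · exact Nat.le_zero.1 ((hr (Fin.le_last j)).trans (hrl.trans h0).le)
  exact ⟨g, hg, fun g' hg' => (hz g' hg').trans (hz g hg).symm⟩

theorem Peg.cell_isPermClass_or (x : Peg) : IsPermClass x.cell ∨ x.cell = {one} := by
  cases x with
  | plus => exact Or.inl (isPermClass_Av _)
  | minus => exact Or.inl (isPermClass_Av _)
  | dot => exact Or.inr rfl

/-- The matrix of a peg permutation is a Struct rule as soon as peg maps to it are unique. -/
theorem isStructRule_matrix {ρ : PegPermutation}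
    (h : ∀ π f f', IsPegMap ρ π f → IsPegMap ρ π f' → f = f') : ρ.matrix.IsStructRule := by
  refine ⟨fun (k l : Fin ρ.perm.length) => ?_, fun π ⟨g, hg⟩ => ⟨g, hg, fun g' hg' => ?_⟩⟩
  · change IsPermClass (if ρ.perm.val k = l then (ρ.peg k).cell else Av {one}) ∨
      (if ρ.perm.val k = l then (ρ.peg k).cell else Av {one}) = {one}
    split_ifs
    · exact Peg.cell_isPermClass_or _
    · exact Or.inl (isPermClass_Av _)
  · obtain ⟨f, hf, rfl⟩ := exists_pegMap_of_isGridding hg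
    obtain ⟨f', hf', rfl⟩ := exists_pegMap_of_isGridding hg'
    rw [h π f f' hf hf']

/-- A class in which some run can be arbitrarily long contains all monotone permutations of the
corresponding direction. -/
theorem IsThreshold.cell_mem_blockSet {C : Set Permutation} {R N : ℕ} (hC : IsPermClass C)
    (hne : C ≠ Set.univ) (hN : IsThreshold C R N) {σ : PegPermutation}
    (hσ : σ.perm.length ≤ R) {π : Permutation} (hπ : π ∈ C) {f} (h : IsPegMap σ π f)
    {i : Fin σ.perm.length} (hi : N ≤ blockSize f i) (hd : σ.peg i ≠ .dot) :
    (σ.peg i).cell ∈ blockSet C := by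
  have hlong : ∀ l, ∃ π' ∈ C, ∃ f', IsPegMap σ π' f' ∧ l ≤ blockSize f' i := fun l => by
    obtain ⟨π', hπ', f', hf', hs⟩ := hN σ hσ
      (Function.update (blockSize f) i (max l N)) ⟨π, hπ, f, h, fun j => by
        by_cases hj : j = i
        · subst hj; exact (min_le_right _ _).trans hi
        · rw [Function.update_of_ne hj]; exact min_le_left _ _⟩ fun j hj => by
        rw [Function.update_of_ne (by rintro rfl; exact hd hj)]
        exact h.blockSize_eq_one hj
    exact ⟨π', hπ', f', hf', by rw [hs, Function.update_self]; exact le_max_left _ _⟩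
  cases hp : σ.peg i with
  | plus =>
    refine Av_singleton_mem_blockSet hC hne (fun p hp' => ?_) infinite_Av_p21
    obtain ⟨π', hπ', f', hf', hl⟩ := hlong p.length
    refine mem_of_contains hC hπ' ((contains_restrict π' (Finset.univ.filter fun x => f' x = i)).trans
      (contains_of_mem_Av_p21 ((restrict_mem_Av_p21_iff _ _).2 ?_) hp' hl))
    intro x hx y hy hxy
    simp only [Finset.mem_filter, Finset.mem_univ, true_and] at hx hy
    exact hf'.plus x y hxy (hx.trans hy.symm) (hx ▸ hp)
  | minus =>
    refine Av_singleton_mem_blockSet hC hne (fun p hp' => ?_) infinite_Av_p12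
    obtain ⟨π', hπ', f', hf', hl⟩ := hlong p.length
    refine mem_of_contains hC hπ' ((contains_restrict π' (Finset.univ.filter fun x => f' x = i)).trans
      (contains_of_mem_Av_p12 ((restrict_mem_Av_p12_iff _ _).2 ?_) hp' hl))
    intro x hx y hy hxy
    simp only [Finset.mem_filter, Finset.mem_univ, true_and] at hx hy
    exact hf'.minus x y hxy (hx.trans hy.symm) (hx ▸ hp)
  | dot => exact absurd hp hd

open Classical in
/-- The rule with underlying permutation `τ`; for the empty permutation it is the empty rule. -/
noncomputable def rule (N : ℕ) (σ : PegPermutation) (τ : Permutation)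
    (f : Fin τ.length → Fin σ.perm.length) : GridMatrix :=
  if τ.length = 0 then GridMatrix.emptyRule else (rulePeg N σ τ f).matrix

theorem mem_grid_rule_iff {N : ℕ} {σ : PegPermutation} {τ : Permutation}
    {f : Fin τ.length → Fin σ.perm.length} {π : Permutation} :
    π ∈ (rule N σ τ f).Grid ↔ ∃ h, IsPegMap (rulePeg N σ τ f) π h := by
  rw [rule]
  split_ifs with hτ
  · rw [mem_grid_emptyRule_iff]
    constructor
    · intro hπ
      have hp : ∀ p : Fin π.length, False := fun p => absurd p.2 (by omega)
      exact ⟨fun p => (hp p).elim, fun p => (hp p).elim, fun p => (hp p).elim,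
        fun p => (hp p).elim, fun p => (hp p).elim, fun x => absurd (show (x : ℕ) < τ.length from x.2) (by omega)⟩
    · rintro ⟨h, -⟩
      by_contra hn
      have := (h ⟨0, Nat.pos_of_ne_zero hn⟩).2
      change _ < τ.length at this
      omega
  · exact mem_grid_matrix_iff

theorem mainTheorem1 (C : Set Permutation) (hC : IsPolynomialClass C) :
    ∃ (K : ℕ) (R : Fin K → GridMatrix),
      IsStructCover C R ∧
      ∀ i, R i = GridMatrix.emptyRule ∨
        ∃ ρ : PegPermutation, 0 < ρ.perm.length ∧ R i = ρ.matrix := by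
  have hCc := hC.1
  obtain ⟨m, hm⟩ := exists_ncard_lt_two_pow hC
  have hne := ne_univ_of_ncard_lt hm
  have hruns : ∀ {σ π f}, IsRunShape σ π f → π ∈ C →
      σ.perm.length ≤ 4 * m * (6 * m + 1) + 1 := fun {σ π f} h hπ => by
    obtain ⟨σ', f', h', hl⟩ := exists_isRunShape π
    obtain rfl := h.shape_eq h'
    exact hl ▸ card_runStarts_le hCc hm hπ
  obtain ⟨N, hN2, hN⟩ := exists_isThreshold hCc (4 * m * (6 * m + 1) + 1)
  -- the members of `C` in which every run of length at least `N` has length `N + 1`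
  let T : Set Permutation := {τ | τ ∈ C ∧ ∃ (σ : PegPermutation) (f : _), IsRunShape σ τ f ∧
    ∀ i, blockSize f i < N ∨ blockSize f i = N + 1}
  have hT : T.Finite := by
    refine (finite_length_le C ((4 * m * (6 * m + 1) + 1) * (N + 1))).subset ?_
    rintro τ ⟨hτ, σ, f, hf, hs⟩
    refine ⟨hτ, ?_⟩
    rw [← sum_blockSize f]
    calc ∑ i, blockSize f i ≤ ∑ _i : Fin σ.perm.length, (N + 1) :=
          Finset.sum_le_sum fun i _ => by rcases hs i with h | h <;> omega
      _ = σ.perm.length * (N + 1) := by simp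
      _ ≤ _ := Nat.mul_le_mul_right _ (hruns hf hτ)
  have := hT.to_subtype
  obtain ⟨K, ⟨e⟩⟩ := Finite.exists_equiv_fin T
  let τ : Fin K → Permutation := fun i => (e.symm i : Permutation)
  have hτC : ∀ i, τ i ∈ C := fun i => (e.symm i).2.1
  have hτ : ∀ i, ∃ (σ : PegPermutation) (f : _), IsRunShape σ (τ i) f ∧
    ∀ j, blockSize f j < N ∨ blockSize f j = N + 1 := fun i => (e.symm i).2.2
  choose σ f hf hs using hτ
  have hone : ∀ i, (τ i).length ≠ 0 → one ∈ C := fun i hi =>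
    mem_of_contains hCc (hτC i) ((contains_one_iff _).2 (Nat.pos_of_ne_zero hi))
  have hrule : ∀ i, (τ i).length ≠ 0 →
      rule N (σ i) (τ i) (f i) = (rulePeg N (σ i) (τ i) (f i)).matrix := fun i hi => if_neg hi
  have hrule0 : ∀ i, (τ i).length = 0 →
      rule N (σ i) (τ i) (f i) = GridMatrix.emptyRule := fun i hi => if_pos hi
  refine ⟨K, fun i => rule N (σ i) (τ i) (f i), ⟨fun i => ?_, fun i => ?_, fun i hi => ?_,
    fun i j hij => ?_, ?_⟩, fun i => ?_⟩
  · dsimp only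
    by_cases h0 : (τ i).length = 0
    · rw [hrule0 i h0]; exact isStructRule_emptyRule
    · rw [hrule i h0]
      exact isStructRule_matrix fun π h h' hh hh' =>
        pegMap_rulePeg_unique hN2 (hf i) (hs i) hh hh'
  · dsimp only
    by_cases h0 : (τ i).length = 0
    · rw [hrule0 i h0]; exact fun _ _ => Or.inl (Or.inr rfl)
    · rw [hrule i h0]
      intro (x : Fin (τ i).length) (y : Fin (τ i).length)
      change (if (τ i).val x = y then ((rulePeg N (σ i) (τ i) (f i)).peg x).cell else Av {one}) ∈ _
      split_ifs
      · by_cases hd : (rulePeg N (σ i) (τ i) (f i)).peg x = .dot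
        · rw [hd]; exact Or.inr ⟨rfl, hone i h0⟩
        · have hx := rulePeg_peg_of_ne_dot hd
          rw [hx.2.2]
          exact hN.cell_mem_blockSet hCc hne (hruns (hf i) (hτC i)) (hτC i) (hf i).toIsPegMap
            (by rw [hx.1]; omega) (hx.2.2 ▸ hd)
      · exact Or.inl (Or.inr rfl)
  · by_cases h0 : (τ i).length = 0
    · exact hrule0 i h0
    · exfalso
      dsimp only at hi
      rw [hrule i h0] at hi
      have hcols : (τ i).length = 1 := congrArg GridMatrix.cols hi
      have hentry : ∀ x y, (rulePeg N (σ i) (τ i) (f i)).matrix.entry x y = C := by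
        rw [hi]; exact fun _ _ => rfl
      let x : Fin (τ i).length := ⟨0, by omega⟩
      have hx : ((rulePeg N (σ i) (τ i) (f i)).peg x).cell = C := by
        have := hentry x ((τ i).val x)
        change (if (τ i).val x = (τ i).val x then _ else _) = C at this
        rwa [if_pos rfl] at this
      -- with a single letter there is no run of length `N + 1`, hence the letter carries a dot
      have hd : (rulePeg N (σ i) (τ i) (f i)).peg x = .dot := by
        by_contra hd
        have h1 := (rulePeg_peg_of_ne_dot hd).1
        have h2 : blockSize (f i) (f i x) ≤ (τ i).length :=
          (Finset.card_le_univ _).trans (by simp)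
        omega
      rw [hd] at hx
      have hε : one.restrict ∅ ∈ C :=
        mem_of_contains hCc (hone i h0) (contains_restrict one ∅)
      rw [← hx] at hε
      exact absurd ((eq_one_iff _).1 hε) (by change ¬ (∅ : Finset (Fin 1)).card = 1; simp)
  · rw [Set.disjoint_left]
    intro π hi hj
    obtain ⟨h, hh⟩ := mem_grid_rule_iff.1 hi
    obtain ⟨h', hh'⟩ := mem_grid_rule_iff.1 hj
    exact hij (e.symm.injective (Subtype.ext
      (eq_of_pegMap_rulePeg hN2 (hf i) (hs i) hh (hf j) (hs j) hh')))
  · ext π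
    rw [Set.mem_iUnion]
    constructor
    · rintro ⟨i, hi⟩
      obtain ⟨h, hh⟩ := mem_grid_rule_iff.1 hi
      have hc := (hf i).comp hN2 (hs i) hh
      exact hN.mem_of_truncate_eq (hruns (hf i) (hτC i)) (hf i).toIsPegMap hc.1.toIsPegMap (hτC i)
        hc.2
    · intro hπ
      obtain ⟨σ', g, hg, -⟩ := exists_isRunShape π
      obtain ⟨τ', hτ', g', hg', ht⟩ := hN.exists_truncate hN2 (hruns hg hπ) hπ hg
      have hT' : τ' ∈ T := ⟨hτ', σ', g', hg', fun i => by
        rw [← ht, truncate]; split_ifs <;> omega⟩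
      refine ⟨e ⟨τ', hT'⟩, mem_grid_rule_iff.2 ?_⟩
      have hτe : τ (e ⟨τ', hT'⟩) = τ' := by simp [τ]
      have hfe := hf (e ⟨τ', hT'⟩)
      generalize e ⟨τ', hT'⟩ = i at *
      subst hτe
      obtain rfl := hfe.shape_eq hg'
      obtain rfl := hfe.map_eq hg'
      exact exists_pegMap_rulePeg (by omega) hfe hg ht
  · by_cases h0 : (τ i).length = 0
    · exact Or.inl (hrule0 i h0)
    · exact Or.inr ⟨rulePeg N (σ i) (τ i) (f i), Nat.pos_of_ne_zero h0, hrule i h0⟩
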